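/- Let $\mathcal O$ be the ring of germs at $0\in\mathbb C$ of holomorphic functions and let $\varepsilon=t\,\frac{d}{dt}$ be the Euler derivation. A *Fuchsian operator* of order $n\ge 0$ is a linear differential operator $L=\sum_{k=0}^{n} r_k\varepsilon^k$ with $r_k\in\mathcal O$ and $r_n(0)\neq 0$; its *Euler part* is the polynomial $\mathcal E(L)=\sum_{k=0}^n r_k(0)\,\varepsilon^k\in\mathbb C[\varepsilon]$. Two Fuchsian operators $L,M$ of the same order are *$\mathcal F$-equivalent* if there are Fuchsian operators $H,K$ (of arbitrary orders) such that $MH=KL$ (composition of operators) and $\gcd(\mathcal E(H),\mathcal E(L))=1$ in $\mathbb C[\varepsilon]$. The solutions of $L$ are the (a priori multivalued) solutions of $Lu=0$, holomorphic in a small punctured disk around the origin. A solution is *meromorphic* (resp. *holomorphic*) if it is single-valued and meromorphic (resp. extends holomorphically) at the origin. Let $L$ be a Fuchsian operator of order $n$. 1. All solutions of $Lu=0$ are meromorphic if and only if $L$ is $\mathcal F$-equivalent to an Euler operator $\prod_{i=1}^n(\varepsilon-\lambda_i)$ with pairwise distinct integers $\lambda_1,\dots,\lambda_n\in\mathbb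 Z$. 2. All solutions of $Lu=0$ are holomorphic if and only if $L$ is $\mathcal F$-equivalent to an Euler operator $\prod_{i=1}^n(\varepsilon-\lambda_i)$ with pairwise distinct nonnegative integers $\lambda_1,\dots,\lambda_n\in\mathbb Z_{\ge 0}$. -/

import Mathlib

open Polynomial Filter Topology

noncomputable section

/-- The ring of germs at the origin of holomorphic functions of one complex variable. -/
def HolGerm : Subring (Germ (𝓝 (0 : ℂ)) ℂ) where
  carrier := {g | ∃ f : ℂ → ℂ, AnalyticAt ℂ f 0 ∧ (f : Germ (𝓝 (0 : ℂ)) ℂ) = g}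
  mul_mem' := by
    rintro _ _ ⟨f, hf, rfl⟩ ⟨g, hg, rfl⟩
    exact ⟨f * g, hf.mul hg, rfl⟩
  one_mem' := ⟨fun _ => 1, analyticAt_const, rfl⟩
  add_mem' := by
    rintro _ _ ⟨f, hf, rfl⟩ ⟨g, hg, rfl⟩
    exact ⟨f + g, hf.add hg, rfl⟩
  zero_mem' := ⟨fun _ => 0, analyticAt_const, rfl⟩
  neg_mem' := by
    rintro _ ⟨f, hf, rfl⟩
    exact ⟨-f, hf.neg, rfl⟩

/-- The value at the origin, as a ring homomorphism. -/
def HolGerm.value : HolGerm →+* ℂ :=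
  (Germ.valueRingHom (X := ℂ) (E := ℂ) (x := 0)).comp HolGerm.subtype

/-- The constant germs. -/
def HolGerm.const : ℂ →+* HolGerm where
  toFun c := ⟨((fun _ => c : ℂ → ℂ) : Germ (𝓝 (0 : ℂ)) ℂ), fun _ => c, analyticAt_const, rfl⟩
  map_one' := rfl
  map_mul' _ _ := rfl
  map_zero' := rfl
  map_add' _ _ := rfl

/-- The Euler derivation `t * d/dt` on functions. -/
def eulerFun (u : ℂ → ℂ) : ℂ → ℂ := fun t => t * deriv u t

/-- The Euler derivation on germs of arbitrary functions; it is used on holomorphic germs only. -/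
def eulerGerm : Germ (𝓝 (0 : ℂ)) ℂ → Germ (𝓝 (0 : ℂ)) ℂ :=
  Germ.map' eulerFun fun f g (h : f =ᶠ[𝓝 0] g) => by
    filter_upwards [h.deriv] with t ht
    simp [eulerFun, ht]

/-- The Euler derivation `t * d/dt` of the ring of holomorphic germs. -/
def HolGerm.euler : Derivation ℤ HolGerm HolGerm :=
  Derivation.mk'
    (AddMonoidHom.toIntLinearMap
      { toFun := fun g => ⟨eulerGerm g.1, by
          obtain ⟨_, f, hf, rfl⟩ := g
          exact ⟨eulerFun f, analyticAt_id.mul hf.deriv, rfl⟩⟩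
        map_zero' := by
          refine Subtype.ext (Germ.coe_eq.2 (Eventually.of_forall fun t => ?_))
          change t * deriv (fun _ => (0 : ℂ)) t = 0
          simp
        map_add' := by
          rintro ⟨_, f, hf, rfl⟩ ⟨_, g, hg, rfl⟩
          refine Subtype.ext (Germ.coe_eq.2 ?_)
          filter_upwards [hf.eventually_analyticAt, hg.eventually_analyticAt] with t h1 h2
          change t * deriv (f + g) t = t * deriv f t + t * deriv g t
          rw [deriv_add h1.differentiableAt h2.differentiableAt]
          ring })
    (by
      rintro ⟨_, f, hf, rfl⟩ ⟨_, g, hg, rfl⟩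
      refine Subtype.ext (Germ.coe_eq.2 ?_)
      filter_upwards [hf.eventually_analyticAt, hg.eventually_analyticAt] with t h1 h2
      change t * deriv (f * g) t = f t * (t * deriv g t) + g t * (t * deriv f t)
      rw [deriv_mul h1.differentiableAt h2.differentiableAt]
      ring)

/-- Holomorphic germs form a differential ring under the Euler derivation. -/
instance : Differential HolGerm := ⟨HolGerm.euler⟩

/-- A differential operator with holomorphic coefficients in standard form: the polynomial
`∑ r_k X ^ k` stands for the operator `∑ r_k ε ^ k`, with coefficients to the left of the powers
of the Euler derivation `ε = t * d/dt`. The zero operator aside, its order is its `natDegree`.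
Sums of operators are sums of polynomials, but the composition of operators is `HolOp.opComp`,
not the commutative product of polynomials. -/
abbrev HolOp : Type := HolGerm[X]

namespace HolOp

/-- The composition `ε ∘ Q`, by the Leibniz rule `ε ∘ b ε ^ j = b ε ^ (j + 1) + ε(b) ε ^ j`. -/
def eulerComp (Q : HolOp) : HolOp := X * Q + Differential.mapCoeffs Q

/-- The composition `P ∘ Q` of differential operators, `∑ a_i ε ^ i ∘ Q` for `P = ∑ a_i ε ^ i`. -/
def opComp (P Q : HolOp) : HolOp := P.sum fun i a => C a * eulerComp^[i] Q

/-- A Fuchsian operator: an operator with holomorphic coefficients with respect to `ε`, the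
leading one of which does not vanish at the origin. (Order zero is allowed, the zero operator is
not Fuchsian.) -/
def IsFuchsian (L : HolOp) : Prop := HolGerm.value L.leadingCoeff ≠ 0

/-- The Euler part of an operator: the polynomial `p_0(ε) = ∑ r_k(0) ε ^ k`, which is the
coefficient at `t ^ 0` in the noncommutative Taylor expansion `∑ t ^ k p_k(ε)`. -/
def eulerPart (L : HolOp) : ℂ[X] := L.map HolGerm.value

/-- The Euler operator `p(ε)` given by a polynomial `p` with constant coefficients. -/
def ofEuler (p : ℂ[X]) : HolOp := p.map HolGerm.const

/-- Fuchsian equivalence of two Fuchsian operators `L`, `M` of the same order: `M H = K L` for some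
Fuchsian operators `H`, `K` (of any orders) such that the Euler parts of `H` and `L` are mutually
prime. -/
def FEquiv (L M : HolOp) : Prop :=
  IsFuchsian L ∧ IsFuchsian M ∧ L.natDegree = M.natDegree ∧
    ∃ H K : HolOp, IsFuchsian H ∧ IsFuchsian K ∧ opComp M H = opComp K L ∧
      IsCoprime (eulerPart H) (eulerPart L)

/-- The functions `a 0, …, a n` represent the coefficients of the operator `L` of order `n` on the
disk of radius `δ` around the origin: they are holomorphic there, and the leading one vanishes
nowhere in the disk, so that the equation has no singularity except the origin. -/
def Represents (L : HolOp) (δ : ℝ) (a : ℕ → ℂ → ℂ) : Prop :=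
  (∀ k ≤ L.natDegree, AnalyticOnNhd ℂ (a k) (Metric.ball 0 δ) ∧
    (a k : Germ (𝓝 (0 : ℂ)) ℂ) = (L.coeff k : HolGerm)) ∧
  ∀ t ∈ Metric.ball (0 : ℂ) δ, a L.natDegree t ≠ 0

/-- `u` is a holomorphic solution near the point `t₀` of the equation
`a n * ε ^ n u + ⋯ + a 1 * ε u + a 0 * u = 0`. -/
def IsLocalSolution (n : ℕ) (a : ℕ → ℂ → ℂ) (t₀ : ℂ) (u : ℂ → ℂ) : Prop :=
  AnalyticAt ℂ u t₀ ∧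
    ∀ᶠ t in 𝓝 t₀, ∑ k ∈ Finset.range (n + 1), a k t * (eulerFun^[k] u) t = 0

/-- All solutions of `L u = 0` are meromorphic at the origin: in some disk around the origin, every
local solution at every point `t₀ ≠ 0` is the germ at `t₀` of a (single-valued) function which is
holomorphic in the punctured disk and meromorphic at the origin. (If this holds in one disk, it
holds in all smaller ones.) -/
def OnlyMeromorphicSolutions (L : HolOp) : Prop :=
  ∃ δ > 0, ∃ a : ℕ → ℂ → ℂ, Represents L δ a ∧
    ∀ t₀ ∈ Metric.ball (0 : ℂ) δ, t₀ ≠ 0 → ∀ u : ℂ → ℂ, IsLocalSolution L.natDegree a t₀ u →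
      ∃ v : ℂ → ℂ, AnalyticOnNhd ℂ v (Metric.ball 0 δ \ {0}) ∧ MeromorphicAt v 0 ∧ v =ᶠ[𝓝 t₀] u

/-- All solutions of `L u = 0` are holomorphic at the origin: in some disk around the origin, every
local solution at every point `t₀ ≠ 0` is the germ at `t₀` of a function which is holomorphic in
the whole disk. -/
def OnlyHolomorphicSolutions (L : HolOp) : Prop :=
  ∃ δ > 0, ∃ a : ℕ → ℂ → ℂ, Represents L δ a ∧
    ∀ t₀ ∈ Metric.ball (0 : ℂ) δ, t₀ ≠ 0 → ∀ u : ℂ → ℂ, IsLocalSolution L.natDegree a t₀ u →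
      ∃ v : ℂ → ℂ, AnalyticOnNhd ℂ v (Metric.ball 0 δ) ∧ v =ᶠ[𝓝 t₀] u

end HolOp

end

/-! Everything rests on comparing an operator with its reduction at the origin. Since `ε = t d/dt`
sends germs to germs vanishing at `0`, the Leibniz corrections in a composition disappear under
evaluation at `0`, and the Euler part is multiplicative: `eulerPart_opComp`.

From solutions to equivalence. The Cauchy problem at a point `t₀ ≠ 0` gives `n` independent
solutions, here assumed to extend to the punctured disk with at most a pole. The orders at `0` of
the nonzero functions in their span take `n` distinct values (`exists_injective_analyticOrderAt`),
so there are solutions `t ^ l i * g i` with distinct integers `l i` and `g i 0 ≠ 0`; if there are no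
poles, `l i ≥ 0`. Conjugating by `t ^ c` turns `ε` into `ε + c`, so one can work with the germs `g
i` alone. Their Wronskian matrix reduces at `0` to an invertible diagonal matrix times the
Vandermonde matrix of `l`, and is therefore invertible over the germs. Hence some `P` of order less
than `n` sends each `t ^ l i * g i` to `t ^ l i`, and `H = P + L` is Fuchsian and does the same.
With `M = ∏ (ε - l i)`, the operator `M H` kills these solutions. So does its remainder on right
division by `L`, which must vanish by invertibility of the Wronskian: `M H = K L`. Finally the roots
of the Euler part of `L` are exactly the `l i`, where the Euler part of `H` is nonzero
(`fEquiv_of_twistAct_eq_zero`).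

From equivalence to solutions. Coprimality of the Euler parts lifts, by Nakayama's lemma over the
local ring of germs, to `U H + V L = 1` (`exists_opComp_add_eq_one`). If `L u = 0`, then `M (H u) =
K (L u) = 0`, so `H u` is a combination of the powers `t ^ l i`, and `u = U (H u)` is the image of
that combination under an operator with holomorphic coefficients. It is therefore meromorphic, and
holomorphic when all `l i ≥ 0`. -/

noncomputable section

/-! ### The local differential ring of holomorphic germs. -/

namespace HolGerm

/-- The germ at the origin of a function which is analytic there. -/
def mk (f : ℂ → ℂ) (hf : AnalyticAt ℂ f 0) : HolGerm := ⟨(f : Germ (𝓝 (0 : ℂ)) ℂ), f, hf, rfl⟩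

lemma exists_eq_mk (g : HolGerm) : ∃ f, ∃ hf : AnalyticAt ℂ f 0, g = mk f hf := by
  obtain ⟨_, f, hf, rfl⟩ := g
  exact ⟨f, hf, rfl⟩

lemma mk_eq_mk {f g : ℂ → ℂ} {hf : AnalyticAt ℂ f 0} {hg : AnalyticAt ℂ g 0} :
    mk f hf = mk g hg ↔ f =ᶠ[𝓝 0] g := by
  rw [← Germ.coe_eq]
  exact Subtype.ext_iff

lemma value_mk (f : ℂ → ℂ) (hf : AnalyticAt ℂ f 0) : value (mk f hf) = f 0 := rfl

lemma value_const (c : ℂ) : value (const c) = c := rfl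

/-- The factor `t` in `ε` kills the value; this is what makes Euler parts multiply under
composition. -/
lemma value_deriv (g : HolGerm) : value (Differential.deriv g) = 0 := by
  obtain ⟨f, hf, rfl⟩ := exists_eq_mk g
  change 0 * deriv f 0 = 0
  simp

lemma deriv_const (c : ℂ) : Differential.deriv (const c) = 0 := by
  refine mk_eq_mk (f := eulerFun fun _ => c) (g := fun _ => 0)
    (hf := analyticAt_id.mul (analyticAt_const (v := c)).deriv) (hg := analyticAt_const) |>.2 ?_
  refine Eventually.of_forall fun t => ?_
  simp [eulerFun]

lemma isUnit_of_value_ne_zero {g : HolGerm} (hg : value g ≠ 0) : IsUnit g := by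
  obtain ⟨f, hf, rfl⟩ := exists_eq_mk g
  rw [value_mk] at hg
  refine IsUnit.of_mul_eq_one (mk (fun t => (f t)⁻¹) (hf.inv hg)) ?_
  refine mk_eq_mk (f := fun t => f t * (f t)⁻¹) (g := fun _ => 1)
    (hf := hf.mul (hf.inv hg)) (hg := analyticAt_const) |>.2 ?_
  filter_upwards [hf.continuousAt.eventually_ne hg] with t ht
  exact mul_inv_cancel₀ ht

/-- Germs with nonzero value are units, so the germs form a local ring; this form is the hypothesis
of Nakayama's lemma. -/
lemma ker_value_le_jacobson : RingHom.ker value ≤ Ideal.jacobson ⊥ := by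
  intro x hx
  refine Ideal.mem_jacobson_bot.2 fun y => isUnit_of_value_ne_zero ?_
  simp [RingHom.mem_ker.1 hx]

end HolGerm

/-! ### Composition of operators: orders, Euler parts, division, Bezout identity. -/

namespace HolOp

lemma eulerComp_add (P Q : HolOp) : eulerComp (P + Q) = eulerComp P + eulerComp Q := by
  simp only [eulerComp, map_add]
  ring

lemma eulerComp_monomial (k : ℕ) (a : HolGerm) :
    eulerComp (monomial k a) = monomial (k + 1) a + monomial k (Differential.deriv a) := by
  rw [eulerComp, X_mul_monomial, Differential.mapCoeffs_monomial]

lemma natDegree_eulerComp_le {Q : HolOp} {m : ℕ} (h : Q.natDegree ≤ m) :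
    (eulerComp Q).natDegree ≤ m + 1 := by
  rw [natDegree_le_iff_coeff_eq_zero] at h ⊢
  intro N hN
  obtain ⟨N, rfl⟩ := Nat.exists_eq_add_of_lt hN
  rw [eulerComp, coeff_add, Differential.coeff_mapCoeffs, coeff_X_mul, h _ (by omega),
    h _ (by omega), map_zero, add_zero]

lemma coeff_eulerComp {Q : HolOp} {m : ℕ} (h : Q.natDegree ≤ m) :
    (eulerComp Q).coeff (m + 1) = Q.coeff m := by
  rw [eulerComp, coeff_add, Differential.coeff_mapCoeffs, coeff_X_mul,
    coeff_eq_zero_of_natDegree_lt (n := m + 1) (by omega), map_zero, add_zero]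

lemma natDegree_eulerComp_iterate_le {Q : HolOp} {m : ℕ} (h : Q.natDegree ≤ m) (i : ℕ) :
    (eulerComp^[i] Q).natDegree ≤ i + m := by
  induction i with
  | zero => simpa using h
  | succ i ih =>
    rw [Function.iterate_succ_apply', add_right_comm]
    exact natDegree_eulerComp_le ih

lemma coeff_eulerComp_iterate {Q : HolOp} {m : ℕ} (h : Q.natDegree ≤ m) (i : ℕ) :
    (eulerComp^[i] Q).coeff (i + m) = Q.coeff m := by
  induction i with
  | zero => simp
  | succ i ih =>
    rw [Function.iterate_succ_apply', add_right_comm,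
      coeff_eulerComp (natDegree_eulerComp_iterate_le h i), ih]

lemma opComp_add (P₁ P₂ Q : HolOp) : opComp (P₁ + P₂) Q = opComp P₁ Q + opComp P₂ Q :=
  sum_add_index _ _ _ (by simp) (by intros; simp [add_mul])

lemma opComp_monomial (k : ℕ) (a : HolGerm) (Q : HolOp) :
    opComp (monomial k a) Q = C a * eulerComp^[k] Q :=
  sum_monomial_index _ _ (by simp)

lemma opComp_smul (a : HolGerm) (P Q : HolOp) : opComp (a • P) Q = a • opComp P Q := by
  induction P using Polynomial.induction_on' with
  | add P₁ P₂ h₁ h₂ => rw [smul_add, opComp_add, opComp_add, h₁, h₂, smul_add]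
  | monomial k b =>
    rw [smul_monomial, opComp_monomial, opComp_monomial, smul_eq_C_mul, smul_eq_mul, C_mul,
      mul_assoc]

/-- Composition with a fixed operator on the right, a linear map over the germs. -/
def opCompRight (Q : HolOp) : HolOp →ₗ[HolGerm] HolOp where
  toFun P := opComp P Q
  map_add' P₁ P₂ := opComp_add P₁ P₂ Q
  map_smul' a P := opComp_smul a P Q

lemma opComp_eq_sum_range {P : HolOp} {n : ℕ} (hP : P.natDegree ≤ n) (Q : HolOp) :
    opComp P Q = ∑ i ∈ Finset.range (n + 1), C (P.coeff i) * eulerComp^[i] Q :=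
  sum_over_range' _ (by simp) _ (by omega)

lemma natDegree_opComp_le {P Q : HolOp} {n m : ℕ} (hP : P.natDegree ≤ n) (hQ : Q.natDegree ≤ m) :
    (opComp P Q).natDegree ≤ n + m := by
  rw [opComp_eq_sum_range hP]
  refine natDegree_sum_le_of_forall_le _ _ fun i hi => ?_
  refine (natDegree_C_mul_le _ _).trans ((natDegree_eulerComp_iterate_le hQ i).trans ?_)
  have := Finset.mem_range.1 hi
  omega

/-- The Leibniz corrections have lower order, so top coefficients multiply as for polynomials. With
bounds in place of exact degrees, no nonvanishing has to be assumed. -/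
lemma coeff_opComp {P Q : HolOp} {n m : ℕ} (hP : P.natDegree ≤ n) (hQ : Q.natDegree ≤ m) :
    (opComp P Q).coeff (n + m) = P.coeff n * Q.coeff m := by
  rw [opComp_eq_sum_range hP, finsetSum_coeff, Finset.sum_eq_single_of_mem n (by simp)]
  · rw [coeff_C_mul, coeff_eulerComp_iterate hQ]
  · intro i hi hin
    have := Finset.mem_range.1 hi
    rw [coeff_C_mul, coeff_eq_zero_of_natDegree_lt (p := eulerComp^[i] Q), mul_zero]
    exact (natDegree_eulerComp_iterate_le hQ i).trans_lt (by omega)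

lemma eulerPart_eulerComp (Q : HolOp) : eulerPart (eulerComp Q) = X * eulerPart Q := by
  ext k
  simp only [eulerPart, eulerComp, Polynomial.map_add, Polynomial.map_mul, map_X, coeff_add,
    coeff_map, Differential.coeff_mapCoeffs, HolGerm.value_deriv, add_zero]

/-- Coefficients differentiated by `ε` have value `0`, so modulo the maximal ideal composition is
the commutative product. -/
lemma eulerPart_opComp (P Q : HolOp) : eulerPart (opComp P Q) = eulerPart P * eulerPart Q := by
  induction P using Polynomial.induction_on' with
  | add P₁ P₂ h₁ h₂ =>
    rw [opComp_add]
    simp only [eulerPart, Polynomial.map_add] at *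
    rw [h₁, h₂, add_mul]
  | monomial k a =>
    have (i : ℕ) : eulerPart (eulerComp^[i] Q) = X ^ i * eulerPart Q := by
      induction i with
      | zero => simp
      | succ i ih => rw [Function.iterate_succ_apply', eulerPart_eulerComp, ih, pow_succ']; ring
    have h := this k
    simp only [eulerPart] at h ⊢
    rw [opComp_monomial, Polynomial.map_mul, h, map_C, map_monomial, ← C_mul_X_pow_eq_monomial, mul_assoc]

lemma IsFuchsian.ne_zero {L : HolOp} (hL : IsFuchsian L) : L ≠ 0 := by
  rintro rfl
  simp [IsFuchsian] at hL

lemma IsFuchsian.natDegree_eulerPart {L : HolOp} (hL : IsFuchsian L) :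
    (eulerPart L).natDegree = L.natDegree :=
  natDegree_map_of_leadingCoeff_ne_zero _ hL

lemma IsFuchsian.eulerPart_ne_zero {L : HolOp} (hL : IsFuchsian L) : eulerPart L ≠ 0 := by
  intro h
  apply hL
  rw [leadingCoeff, ← coeff_map, ← eulerPart, h, coeff_zero]

lemma IsFuchsian.isUnit_leadingCoeff {L : HolOp} (hL : IsFuchsian L) : IsUnit L.leadingCoeff :=
  HolGerm.isUnit_of_value_ne_zero hL

/-- A right factor of a Fuchsian operator by a Fuchsian operator leaves a Fuchsian left factor. -/
lemma IsFuchsian.of_opComp {K L : HolOp} (hL : IsFuchsian L) (h : IsFuchsian (opComp K L)) :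
    IsFuchsian K := by
  have hK : K ≠ 0 := by
    rintro rfl
    apply h.ne_zero
    exact map_zero (opCompRight L)
  have hc := coeff_opComp (le_refl K.natDegree) (le_refl L.natDegree)
  have hne : K.leadingCoeff * L.leadingCoeff ≠ 0 := by
    rw [Ne, hL.isUnit_leadingCoeff.mul_left_eq_zero, leadingCoeff_eq_zero]
    exact hK
  have hd : (opComp K L).natDegree = K.natDegree + L.natDegree := by
    refine le_antisymm (natDegree_opComp_le le_rfl le_rfl) (le_natDegree_of_ne_zero ?_)
    rw [hc]
    exact hne
  rw [IsFuchsian, leadingCoeff, hd, hc, map_mul] at h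
  exact left_ne_zero_of_mul h

lemma IsFuchsian.opComp {K L : HolOp} (hK : IsFuchsian K) (hL : IsFuchsian L) :
    IsFuchsian (opComp K L) := by
  have hc := coeff_opComp (le_refl K.natDegree) (le_refl L.natDegree)
  have hne : HolGerm.value (K.leadingCoeff * L.leadingCoeff) ≠ 0 := by
    rw [map_mul]
    exact mul_ne_zero hK hL
  have hd : (HolOp.opComp K L).natDegree = K.natDegree + L.natDegree := by
    refine le_antisymm (natDegree_opComp_le le_rfl le_rfl) (le_natDegree_of_ne_zero ?_)
    rw [hc]
    intro h
    apply hne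
    rw [leadingCoeff, leadingCoeff, h, map_zero]
  rw [IsFuchsian, leadingCoeff, hd, hc]
  exact hne

/-- Right division with remainder by a Fuchsian operator. -/
lemma exists_eq_opComp_add {L : HolOp} (hL : IsFuchsian L) (P : HolOp) :
    ∃ K R : HolOp, P = opComp K L + R ∧ R.degree < L.natDegree := by
  suffices H : ∀ (d : ℕ) (P : HolOp), P.degree < d →
      ∃ K R : HolOp, P = opComp K L + R ∧ R.degree < L.natDegree from
    H (P.natDegree + 1) P (degree_le_natDegree.trans_lt (by norm_cast; omega))
  intro d
  induction d with
  | zero =>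
    intro P hP
    exact ⟨0, P, by simp [opComp], hP.trans_le (by norm_cast; omega)⟩
  | succ d ih =>
    intro P hP
    by_cases hd : d + 1 ≤ L.natDegree
    · exact ⟨0, P, by simp [opComp], hP.trans_le (by exact_mod_cast hd)⟩
    obtain ⟨u, hu⟩ := hL.isUnit_leadingCoeff.exists_left_inv
    -- `A ∘ L` has order at most `d` and the same coefficient of `ε ^ d` as `P`, so subtracting it
    -- lowers the degree bound.
    set A : HolOp := monomial (d - L.natDegree) (P.coeff d * u) with hA
    have hAd : A.natDegree ≤ d - L.natDegree := natDegree_monomial_le _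
    have hdL : d - L.natDegree + L.natDegree = d := by omega
    obtain ⟨K, R, h, hR⟩ := ih (P - opComp A L) (by
      rw [degree_lt_iff_coeff_zero] at hP ⊢
      intro m hm
      rw [coeff_sub]
      rcases hm.eq_or_lt with rfl | hm
      · have := coeff_opComp hAd (le_refl L.natDegree)
        rw [hdL, hA, coeff_monomial_same, mul_assoc, coeff_natDegree, hu, mul_one] at this
        rw [this, sub_self]
      · rw [hP m hm, coeff_eq_zero_of_natDegree_lt, sub_zero]
        exact (natDegree_opComp_le hAd le_rfl).trans_lt (by omega))
    refine ⟨A + K, R, ?_, hR⟩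
    rw [opComp_add, add_assoc, ← h]
    ring

/-- Bezout identity: operators with mutually prime Euler parts generate the unit left ideal. -/
lemma exists_opComp_add_eq_one {H L : HolOp} (hH : IsFuchsian H) (hL : IsFuchsian L)
    (hc : IsCoprime (eulerPart H) (eulerPart L)) :
    ∃ U V : HolOp, opComp U H + opComp V L = 1 := by
  obtain ⟨p, q, hpq⟩ := hc
  set n := L.natDegree
  set m := H.natDegree
  -- The left ideal generated by `H` and `L`, seen as a module over the germs.
  set N : Submodule HolGerm HolOp :=
    LinearMap.range (opCompRight H) ⊔ LinearMap.range (opCompRight L)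
  have hfg : (degreeLT HolGerm (n + m + 1)).FG := by
    classical
    rw [degreeLT_eq_span_X_pow]
    exact Submodule.fg_span (Finset.finite_toSet _)
  -- Nakayama needs a finitely generated module, hence the restriction to operators of order at most
  -- `n + m`. It then suffices to solve the Bezout equation for Euler parts within these orders.
  have hle : degreeLT HolGerm (n + m + 1) ≤ N := by
    refine Submodule.le_of_le_smul_of_le_jacobson_bot hfg HolGerm.ker_value_le_jacobson ?_
    intro P hP
    set e := eulerPart P
    -- Multiplying the Bezout identity by `e` gives cofactors of uncontrolled degree. Reducing the
    -- first modulo `eulerPart L` and moving the quotient to the second bounds the first directly,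
    -- and the second through `v * eulerPart L = e - u * eulerPart H`.
    set u := (e * p) % eulerPart L with hu
    set v := e * q + (e * p) / eulerPart L * eulerPart H with hv
    have hsum : u * eulerPart H + v * eulerPart L = e := by
      have h1 := EuclideanDomain.div_add_mod (e * p) (eulerPart L)
      calc _ = (eulerPart L * (e * p / eulerPart L) + (e * p) % eulerPart L) * eulerPart H
            + e * q * eulerPart L := by rw [hv, hu]; ring
        _ = e * (p * eulerPart H + q * eulerPart L) := by rw [h1]; ring
        _ = e := by rw [hpq, mul_one]
    have hul : u.natDegree ≤ n := by
      have := degree_mod_lt (e * p) hL.eulerPart_ne_zero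
      rw [← hu] at this
      exact (natDegree_le_natDegree this.le).trans_eq hL.natDegree_eulerPart
    have heP : e.natDegree ≤ n + m := by
      refine natDegree_map_le.trans ?_
      rw [mem_degreeLT] at hP
      exact natDegree_le_of_degree_le (Order.lt_succ_iff.1 hP)
    have hvl : v.natDegree ≤ m := by
      by_cases h0 : v = 0
      · simp [h0]
      have h2 : (v * eulerPart L).natDegree ≤ n + m := by
        rw [← eq_sub_iff_add_eq'] at hsum
        rw [hsum]
        refine (natDegree_sub_le _ _).trans (max_le heP ?_)
        refine natDegree_mul_le.trans (add_le_add hul ?_)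
        rw [hH.natDegree_eulerPart]
      rw [natDegree_mul h0 hL.eulerPart_ne_zero, hL.natDegree_eulerPart] at h2
      omega
    set S : HolOp := opComp (ofEuler u) H + opComp (ofEuler v) L with hS
    have hE (w : ℂ[X]) : eulerPart (ofEuler w) = w := by
      ext k
      simp [eulerPart, ofEuler, HolGerm.value_const]
    have hSe : eulerPart S = e := by
      rw [hS, eulerPart, Polynomial.map_add, ← eulerPart, ← eulerPart, eulerPart_opComp,
        eulerPart_opComp, hE, hE, hsum]
    have hSd : S.natDegree ≤ n + m := by
      refine (natDegree_add_le _ _).trans (max_le ?_ ?_)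
      · exact natDegree_opComp_le (natDegree_map_le.trans hul) le_rfl
      · rw [add_comm]
        exact natDegree_opComp_le (natDegree_map_le.trans hvl) le_rfl
    -- `S` lies in `N` and has the Euler part of `P`, so all coefficients of `P - S` vanish at the
    -- origin.
    suffices S + (P - S) ∈ N ⊔ RingHom.ker HolGerm.value • degreeLT HolGerm (n + m + 1) by
      simpa using this
    refine Submodule.add_mem_sup ?_ ?_
    · exact Submodule.add_mem_sup ⟨ofEuler u, rfl⟩ ⟨ofEuler v, rfl⟩
    · rw [as_sum_range_C_mul_X_pow' (p := P - S) (n := n + m + 1)]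
      · refine Submodule.sum_mem _ fun i hi => ?_
        rw [← smul_eq_C_mul]
        refine Submodule.smul_mem_smul ?_ ?_
        · rw [RingHom.mem_ker, coeff_sub, map_sub, sub_eq_zero, ← coeff_map, ← coeff_map]
          exact congrArg (fun z : ℂ[X] => z.coeff i) hSe.symm
        · rw [mem_degreeLT]
          refine (degree_X_pow_le i).trans_lt ?_
          exact_mod_cast Finset.mem_range.1 hi
      · refine (natDegree_sub_le _ _).trans_lt (max_lt ?_ (by omega))
        rw [mem_degreeLT] at hP
        exact Nat.lt_succ_of_le (natDegree_le_of_degree_le (Order.lt_succ_iff.1 hP))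
  have h1 : (1 : HolOp) ∈ degreeLT HolGerm (n + m + 1) := by
    rw [mem_degreeLT]
    refine degree_one_le.trans_lt ?_
    exact_mod_cast Nat.succ_pos (n + m)
  obtain ⟨_, ⟨U, rfl⟩, _, ⟨V, rfl⟩, h⟩ := Submodule.mem_sup.1 (hle h1)
  exact ⟨U, V, h⟩

end HolOp

/-! ### Conjugation by powers of `t` and the Wronskian criterion for equivalence. -/

namespace HolGerm

/-- The derivation `ε + c`, the conjugate of `ε` by the power function `t ^ c`. -/
def twist (c : ℂ) (g : HolGerm) : HolGerm := Differential.deriv g + const c * g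

lemma twist_add (c : ℂ) (g h : HolGerm) : twist c (g + h) = twist c g + twist c h := by
  simp only [twist, map_add]
  ring

lemma twist_mul (c : ℂ) (a g : HolGerm) :
    twist c (a * g) = a * twist c g + Differential.deriv a * g := by
  simp only [twist, Derivation.leibniz, smul_eq_mul]
  ring

lemma value_twist_iterate (c : ℂ) (g : HolGerm) (k : ℕ) :
    value ((twist c)^[k] g) = c ^ k * value g := by
  induction k with
  | zero => simp
  | succ k ih =>
    rw [Function.iterate_succ_apply', twist, map_add, value_deriv, map_mul, ih, value_const]
    ring

lemma twist_iterate_one (c : ℂ) (k : ℕ) : (twist c)^[k] 1 = const (c ^ k) := by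
  induction k with
  | zero => simp
  | succ k ih => rw [Function.iterate_succ_apply', ih, twist, deriv_const, zero_add, ← map_mul,
      pow_succ']

end HolGerm

namespace HolOp

open HolGerm

/-- The action on germs of the conjugate of an operator by the power function `t ^ c`. -/
def twistAct (c : ℂ) (P : HolOp) (g : HolGerm) : HolGerm := P.sum fun k a => a * (twist c)^[k] g

lemma twistAct_add (c : ℂ) (P Q : HolOp) (g : HolGerm) :
    twistAct c (P + Q) g = twistAct c P g + twistAct c Q g :=
  sum_add_index _ _ _ (by simp) (by intros; simp [add_mul])

lemma twistAct_monomial (c : ℂ) (k : ℕ) (a g : HolGerm) :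
    twistAct c (monomial k a) g = a * (twist c)^[k] g :=
  sum_monomial_index _ _ (by simp)

lemma twistAct_zero_right (c : ℂ) (P : HolOp) : twistAct c P 0 = 0 := by
  refine Finset.sum_eq_zero fun k _ => ?_
  beta_reduce
  rw [Function.iterate_fixed (by simp [twist]), mul_zero]

lemma twistAct_C_mul (c : ℂ) (a : HolGerm) (P : HolOp) (g : HolGerm) :
    twistAct c (C a * P) g = a * twistAct c P g := by
  induction P using Polynomial.induction_on' with
  | add P₁ P₂ h₁ h₂ => rw [mul_add, twistAct_add, twistAct_add, h₁, h₂, mul_add]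
  | monomial k b => rw [C_mul_monomial, twistAct_monomial, twistAct_monomial, mul_assoc]

lemma twistAct_eulerComp (c : ℂ) (Q : HolOp) (g : HolGerm) :
    twistAct c (eulerComp Q) g = twist c (twistAct c Q g) := by
  induction Q using Polynomial.induction_on' with
  | add P₁ P₂ h₁ h₂ => rw [eulerComp_add, twistAct_add, twistAct_add, h₁, h₂, twist_add]
  | monomial k b =>
    rw [eulerComp_monomial, twistAct_add, twistAct_monomial, twistAct_monomial,
      twistAct_monomial, twist_mul, Function.iterate_succ_apply']

lemma twistAct_opComp (c : ℂ) (P Q : HolOp) (g : HolGerm) :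
    twistAct c (opComp P Q) g = twistAct c P (twistAct c Q g) := by
  induction P using Polynomial.induction_on' with
  | add P₁ P₂ h₁ h₂ => rw [opComp_add, twistAct_add, twistAct_add, h₁, h₂]
  | monomial k b =>
    rw [opComp_monomial, twistAct_C_mul, twistAct_monomial]
    congr 1
    induction k with
    | zero => rfl
    | succ k ih =>
      rw [Function.iterate_succ_apply', Function.iterate_succ_apply', twistAct_eulerComp, ih]

/-- Evaluation at `0` turns `ε + c` into multiplication by `c`. Thus `t ^ c * g` with `g 0 ≠ 0` can
be a solution only if `c` is a root of the Euler part. -/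
lemma value_twistAct (c : ℂ) (P : HolOp) (g : HolGerm) :
    value (twistAct c P g) = (eulerPart P).eval c * value g := by
  induction P using Polynomial.induction_on' with
  | add P₁ P₂ h₁ h₂ =>
    rw [twistAct_add, map_add, h₁, h₂, eulerPart, eulerPart, eulerPart, Polynomial.map_add,
      eval_add, add_mul]
  | monomial k b =>
    rw [twistAct_monomial, eulerPart, map_monomial, eval_monomial, map_mul, value_twist_iterate,
      mul_assoc]

lemma twistAct_ofEuler_one (c : ℂ) (p : ℂ[X]) : twistAct c (ofEuler p) 1 = const (p.eval c) := by
  induction p using Polynomial.induction_on' with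
  | add P₁ P₂ h₁ h₂ =>
    rw [ofEuler, Polynomial.map_add, ← ofEuler, ← ofEuler, twistAct_add, h₁, h₂, eval_add, map_add]
  | monomial k b =>
    rw [ofEuler, map_monomial, twistAct_monomial, twist_iterate_one, eval_monomial, map_mul]

lemma isFuchsian_ofEuler {p : ℂ[X]} (hp : p ≠ 0) : IsFuchsian (ofEuler p) := by
  rw [IsFuchsian, ofEuler, leadingCoeff_map_of_leadingCoeff_ne_zero, value_const]
  · exact leadingCoeff_ne_zero.2 hp
  · intro h
    apply leadingCoeff_ne_zero.2 hp
    rw [← value_const p.leadingCoeff, h, map_zero]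

lemma natDegree_ofEuler (p : ℂ[X]) : (ofEuler p).natDegree = p.natDegree := by
  refine natDegree_map_eq_of_injective (fun a b h => ?_) p
  rw [← value_const a, h, value_const]

lemma natDegree_ofEuler_prod {n : ℕ} (l : Fin n → ℂ) :
    (ofEuler (∏ i, (X - C (l i)))).natDegree = n := by
  rw [natDegree_ofEuler, natDegree_finsetProd_X_sub_C_eq_card, Finset.card_univ, Fintype.card_fin]

/-- The Wronskian matrix of the functions `t ^ l i * g i`, divided by the powers of `t`. -/
def wronskian {n : ℕ} (l : Fin n → ℂ) (g : Fin n → HolGerm) : Matrix (Fin n) (Fin n) HolGerm :=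
  Matrix.of fun i k => (twist (l i))^[k] (g i)

/-- At the origin the matrix is the diagonal matrix of the values of `g` times the Vandermonde
matrix of `l`; its determinant is thus a germ with nonzero value. -/
lemma isUnit_wronskian {n : ℕ} {l : Fin n → ℂ} (hl : Function.Injective l) {g : Fin n → HolGerm}
    (hg : ∀ i, value (g i) ≠ 0) : IsUnit (wronskian l g) := by
  rw [Matrix.isUnit_iff_isUnit_det]
  apply isUnit_of_value_ne_zero
  rw [RingHom.map_det]
  have : value.mapMatrix (wronskian l g) =
      Matrix.diagonal (fun i => value (g i)) * Matrix.vandermonde l := by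
    ext i k
    simp [wronskian, value_twist_iterate, Matrix.vandermonde_apply, mul_comm]
  rw [this, Matrix.det_mul, Matrix.det_diagonal]
  exact mul_ne_zero (Finset.prod_ne_zero_iff.2 fun i _ => hg i)
    (Matrix.det_vandermonde_ne_zero_iff.2 hl)

lemma wronskian_mulVec {n : ℕ} (l : Fin n → ℂ) (g : Fin n → HolGerm) {P : HolOp}
    (hP : P.degree < n) :
    (wronskian l g).mulVec (fun k => P.coeff k) = fun i => twistAct (l i) P (g i) := by
  ext1 i
  have h : twistAct (l i) P (g i) =
      ∑ k ∈ Finset.range n, P.coeff k * (twist (l i))^[k] (g i) := by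
    cases n with
    | zero => exact i.elim0
    | succ n =>
      exact sum_over_range' _ (by simp) _
        (Nat.lt_succ_of_le (natDegree_le_of_degree_le (Order.lt_succ_iff.1 hP)))
  rw [h, ← Fin.sum_univ_eq_sum_range fun k => P.coeff k * (twist (l i))^[k] (g i)]
  simp only [Matrix.mulVec, dotProduct, wronskian, Matrix.of_apply, mul_comm]

/-- The coefficients of `P` solve a linear system with the invertible Wronskian matrix. In terms of
functions, `P` sends every `t ^ l i * g i` to `t ^ l i`. -/
lemma exists_twistAct_eq_one {n : ℕ} {l : Fin n → ℂ} (hl : Function.Injective l)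
    {g : Fin n → HolGerm} (hg : ∀ i, value (g i) ≠ 0) :
    ∃ P : HolOp, P.degree < n ∧ ∀ i, twistAct (l i) P (g i) = 1 := by
  obtain ⟨v, hv⟩ := (Matrix.mulVec_surjective_iff_isUnit.2 (isUnit_wronskian hl hg)) fun _ => 1
  obtain ⟨P, hP⟩ := (degreeLTEquiv HolGerm n).surjective v
  refine ⟨P, mem_degreeLT.1 P.2, fun i => ?_⟩
  rw [← congrFun (wronskian_mulVec l g (mem_degreeLT.1 P.2)) i, ← congrFun hv i, ← hP]
  rfl

lemma eq_zero_of_twistAct_eq_zero {n : ℕ} {l : Fin n → ℂ} (hl : Function.Injective l)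
    {g : Fin n → HolGerm} (hg : ∀ i, value (g i) ≠ 0) {P : HolOp} (hP : P.degree < n)
    (h : ∀ i, twistAct (l i) P (g i) = 0) : P = 0 := by
  have h1 := wronskian_mulVec l g hP
  have h2 : (fun k : Fin n => P.coeff k) = 0 :=
    (Matrix.mulVec_injective_of_isUnit (isUnit_wronskian hl hg))
      (by rw [h1, Matrix.mulVec_zero]; exact funext h)
  ext1 k
  by_cases hk : k < n
  · exact congrFun h2 ⟨k, hk⟩
  · exact (degree_lt_iff_coeff_zero _ _).1 hP k (by omega)

/-- A Fuchsian operator with solutions `t ^ l i * g i`, for as many distinct exponents as its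
order and holomorphic `g i` without zero at the origin, is equivalent to an Euler operator. -/
theorem fEquiv_of_twistAct_eq_zero {L : HolOp} (hL : IsFuchsian L) {l : Fin L.natDegree → ℂ}
    (hl : Function.Injective l) {g : Fin L.natDegree → HolGerm} (hg : ∀ i, value (g i) ≠ 0)
    (h : ∀ i, twistAct (l i) L (g i) = 0) :
    FEquiv L (ofEuler (∏ i, (X - C (l i)))) := by
  have hM : IsFuchsian (ofEuler (∏ i, (X - C (l i)))) :=
    isFuchsian_ofEuler (monic_prod_X_sub_C _ _).ne_zero
  obtain ⟨P, hP, hPg⟩ := exists_twistAct_eq_one hl hg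
  have hPL : P.degree < L.degree := by rwa [degree_eq_natDegree hL.ne_zero]
  -- Adding `L` does not change the images of the solutions, and it supplies the leading coefficient
  -- that `P` need not have.
  have hH : IsFuchsian (P + L) := by
    rw [IsFuchsian, leadingCoeff_add_of_degree_lt hPL]
    exact hL
  have hHg (i) : twistAct (l i) (P + L) (g i) = 1 := by rw [twistAct_add, hPg, h, add_zero]
  obtain ⟨K, R, hK, hR⟩ := exists_eq_opComp_add hL (opComp (ofEuler (∏ i, (X - C (l i)))) (P + L))
  -- The Euler operator kills `t ^ l i`, the image of the `i`-th solution under `P + L`. So `R`, of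
  -- order less than `n`, kills `n` solutions.
  have hR0 : R = 0 := by
    refine eq_zero_of_twistAct_eq_zero hl hg hR fun i => ?_
    have h1 := congrArg (fun Q => twistAct (l i) Q (g i)) hK
    simp only [twistAct_opComp, twistAct_add _ (opComp K L)] at h1
    rw [hHg, h, twistAct_ofEuler_one, eval_prod,
      Finset.prod_eq_zero (Finset.mem_univ i) (by simp), map_zero] at h1
    rw [twistAct_zero_right, zero_add] at h1
    exact h1.symm
  rw [hR0, add_zero] at hK
  refine ⟨hL, hM, (natDegree_ofEuler_prod l).symm, P + L, K, hH,
    hL.of_opComp (hK ▸ hM.opComp hH), hK, ?_⟩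
  rw [isCoprime_iff_aeval_ne_zero_of_isAlgClosed ℂ ℂ]
  intro z
  simp only [coe_aeval_eq_eval]
  by_cases hz : ∃ i, l i = z
  · obtain ⟨i, rfl⟩ := hz
    left
    have := value_twistAct (l i) (P + L) (g i)
    rw [hHg, map_one] at this
    intro h0
    simp [h0] at this
  · right
    intro h0
    have hroot (i) : (eulerPart L).IsRoot (l i) := by
      have := value_twistAct (l i) L (g i)
      rw [h, map_zero] at this
      exact (mul_eq_zero.1 this.symm).resolve_right (hg i)
    -- A further root `z` would give `eulerPart L` more roots than its degree.
    have hsub : insert z (Finset.univ.image l) ⊆ (eulerPart L).roots.toFinset := by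
      intro w hw
      rw [Multiset.mem_toFinset, mem_roots hL.eulerPart_ne_zero]
      rcases Finset.mem_insert.1 hw with rfl | hw
      · exact h0
      · obtain ⟨i, -, rfl⟩ := Finset.mem_image.1 hw
        exact hroot i
    have hcard := (Finset.card_le_card hsub).trans
      ((Multiset.toFinset_card_le _).trans (card_roots' _))
    rw [Finset.card_insert_of_notMem (by simpa using hz), Finset.card_image_of_injective _ hl,
      Finset.card_univ, Fintype.card_fin, hL.natDegree_eulerPart] at hcard
    omega

end HolOp

/-! ### The Cauchy problem for linear holomorphic systems, by power series. -/

lemma AnalyticAt.eventuallyEq_of_iteratedDeriv_eq {f g : ℂ → ℂ} {z : ℂ} (hf : AnalyticAt ℂ f z)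
    (hg : AnalyticAt ℂ g z) (h : ∀ k, iteratedDeriv k f z = iteratedDeriv k g z) :
    f =ᶠ[𝓝 z] g := by
  have htop : analyticOrderAt (f - g) z = ⊤ := by
    refine ENat.eq_top_iff_forall_ge.2 fun n => ?_
    rw [natCast_le_analyticOrderAt_iff_iteratedDeriv_eq_zero (hf.sub hg)]
    intro i _
    rw [iteratedDeriv_sub hf.contDiffAt hg.contDiffAt, h, sub_self]
  filter_upwards [analyticOrderAt_eq_top.1 htop] with t ht
  exact sub_eq_zero.1 ht

/-- The Taylor coefficients of the solution of a linear system with coefficients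
`∑ α i j l * z ^ l` and initial value `y₀`. -/
def linearODESeq {ι : Type*} [Fintype ι] (α : ι → ι → ℕ → ℂ) (y₀ : ι → ℂ) : ℕ → ι → ℂ
  | 0 => y₀
  | k + 1 => fun i =>
    (∑ l : Fin (k + 1), ∑ j, α i j (k - l) * linearODESeq α y₀ l j) / (k + 1)
  decreasing_by exact l.2

/-- By induction each summand of the recursion is at most `c * s ^ (k - l) * b * s ^ l = c * b * s ^
k`. The `k + 1` values of `l` cancel the denominator and the sum over `j` contributes `card ι`, so
`s` must dominate `r` and `card ι * c`. -/
lemma norm_linearODESeq_le {ι : Type*} [Fintype ι] {α : ι → ι → ℕ → ℂ} {c r : ℝ} (hc : 0 < c)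
    (hr : 0 < r) (hα : ∀ i j l, ‖α i j l‖ ≤ c * r ^ l) (y₀ : ι → ℂ) (k : ℕ) (i : ι) :
    ‖linearODESeq α y₀ k i‖ ≤ (∑ j, ‖y₀ j‖) * (r + Fintype.card ι * c) ^ k := by
  set s := r + Fintype.card ι * c with hs
  set b := ∑ j, ‖y₀ j‖
  have hb : 0 ≤ b := Finset.sum_nonneg fun j _ => norm_nonneg _
  have hrs : r ≤ s := by rw [hs]; exact le_add_of_nonneg_right (by positivity)
  have hcs : Fintype.card ι * c ≤ s := by rw [hs]; exact le_add_of_nonneg_left hr.le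
  have hs0 : 0 < s := hr.trans_le hrs
  induction k using Nat.strong_induction_on generalizing i with
  | _ k ih =>
  cases k with
  | zero =>
    rw [linearODESeq, pow_zero, mul_one]
    exact Finset.single_le_sum (f := fun j => ‖y₀ j‖) (fun j _ => norm_nonneg _)
      (Finset.mem_univ i)
  | succ k =>
    rw [linearODESeq, norm_div]
    have hk : ‖(k + 1 : ℂ)‖ = k + 1 := by
      rw [← Nat.cast_succ, Complex.norm_natCast, Nat.cast_succ]
    rw [hk, div_le_iff₀ (by positivity)]
    calc _ ≤ ∑ l : Fin (k + 1), ∑ j : ι, c * (b * s ^ k) := by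
          refine norm_sum_le_of_le _ fun l _ => norm_sum_le_of_le _ fun j _ => ?_
          rw [norm_mul]
          have hl : k - l + l = k := by omega
          calc _ ≤ (c * s ^ (k - l : ℕ)) * (b * s ^ (l : ℕ)) := by
                refine mul_le_mul ((hα _ _ _).trans ?_) (ih l l.2 j) (norm_nonneg _)
                  (by positivity)
                gcongr
            _ = c * (b * s ^ (k - l + l : ℕ)) := by rw [pow_add]; ring
            _ = _ := by rw [hl]
      _ = (Fintype.card ι * c) * (b * s ^ k) * (k + 1) := by
          simp only [Finset.sum_const, Finset.card_univ, Fintype.card_fin, nsmul_eq_mul]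
          push_cast
          ring
      _ ≤ s * (b * s ^ k) * (k + 1) := by gcongr
      _ = _ := by ring

/-- Existence of holomorphic solutions of linear systems with holomorphic coefficients. -/
theorem exists_analyticAt_deriv_eq_sum {ι : Type*} [Fintype ι] {A : ι → ι → ℂ → ℂ} {z₀ : ℂ}
    (hA : ∀ i j, AnalyticAt ℂ (A i j) z₀) (y₀ : ι → ℂ) :
    ∃ y : ι → ℂ → ℂ, (∀ i, AnalyticAt ℂ (y i) z₀) ∧ (∀ i, y i z₀ = y₀ i) ∧
      ∀ i, deriv (y i) =ᶠ[𝓝 z₀] fun z => ∑ j, A i j z * y j z := by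
  set α : ι → ι → ℕ → ℂ := fun i j l => iteratedDeriv l (A i j) z₀ / l.factorial with hα
  have hbound (i j) : ∃ c r : ℝ, 0 < c ∧ 0 < r ∧ ∀ l, ‖α i j l‖ ≤ c * r ^ l := by
    obtain ⟨c, r, hc, hr, h⟩ :=
      FormalMultilinearSeries.le_mul_pow_of_radius_pos _ (hA i j).hasFPowerSeriesAt.radius_pos
    refine ⟨c, r, hc, hr, fun l => ?_⟩
    simpa only [FormalMultilinearSeries.ofScalars_norm] using h l
  choose c r hc hr hcr using hbound
  -- One geometric bound for all entries; the `1` keeps the constants positive when `ι` is empty.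
  set C := 1 + ∑ i, ∑ j, c i j with hC
  set R := 1 + ∑ i, ∑ j, r i j with hR
  have hle (f : ι → ι → ℝ) (hf : ∀ i j, 0 < f i j) (i j) : f i j ≤ 1 + ∑ i, ∑ j, f i j := by
    have h1 : f i j ≤ ∑ j, f i j :=
      Finset.single_le_sum (f := fun j => f i j) (fun j _ => (hf i j).le) (Finset.mem_univ j)
    have h2 : ∑ j, f i j ≤ ∑ i, ∑ j, f i j :=
      Finset.single_le_sum (f := fun i => ∑ j, f i j)
        (fun i _ => Finset.sum_nonneg fun j _ => (hf i j).le) (Finset.mem_univ i)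
    linarith
  have hC0 : 0 < C := by
    have : 0 ≤ ∑ i, ∑ j, c i j :=
      Finset.sum_nonneg fun i _ => Finset.sum_nonneg fun j _ => (hc i j).le
    linarith
  have hR0 : 0 < R := by
    have : 0 ≤ ∑ i, ∑ j, r i j :=
      Finset.sum_nonneg fun i _ => Finset.sum_nonneg fun j _ => (hr i j).le
    linarith
  have hαb (i j l) : ‖α i j l‖ ≤ C * R ^ l := by
    refine (hcr i j l).trans ?_
    have h1 := hle c hc i j
    have h2 := hle r hr i j
    have h3 := hr i j
    gcongr
  set d := linearODESeq α y₀ with hd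
  have hdb := norm_linearODESeq_le hC0 hR0 hαb y₀
  set S := R + Fintype.card ι * C with hS
  have hS0 : 0 < S := by rw [hS]; positivity
  set p : ι → FormalMultilinearSeries ℂ ℂ ℂ :=
    fun i => FormalMultilinearSeries.ofScalars ℂ fun k => d k i with hp
  have hrad (i) : 0 < (p i).radius := by
    have h : ((S⁻¹).toNNReal : ENNReal) ≤ (p i).radius := by
      refine (p i).le_radius_of_bound (∑ j, ‖y₀ j‖) fun n => ?_
      rw [hp, FormalMultilinearSeries.ofScalars_norm, Real.coe_toNNReal _ (by positivity), inv_pow,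
        ← div_eq_mul_inv, div_le_iff₀ (by positivity)]
      exact hdb n i
    refine lt_of_lt_of_le ?_ h
    simpa using hS0
  set y : ι → ℂ → ℂ := fun i z => (p i).sum (z - z₀) with hy
  have hps (i) : HasFPowerSeriesAt (y i) (p i) z₀ := by
    have := ((p i).hasFPowerSeriesOnBall (hrad i)).comp_sub z₀
    rw [zero_add] at this
    exact this.hasFPowerSeriesAt
  have han (i) : AnalyticAt ℂ (y i) z₀ := (hps i).analyticAt
  have hcoef (i k) : iteratedDeriv k (y i) z₀ = k.factorial * d k i := by
    have h1 := (hps i).eq_formalMultilinearSeries (han i).hasFPowerSeriesAt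
    have h2 := congrFun (FormalMultilinearSeries.ofScalars_series_injective ℂ ℂ h1) k
    rw [h2, mul_div_cancel₀]
    exact_mod_cast k.factorial_ne_zero
  refine ⟨y, han, fun i => ?_, fun i => ?_⟩
  · have := hcoef i 0
    rw [iteratedDeriv_zero, Nat.factorial_zero, Nat.cast_one, one_mul, hd, linearODESeq] at this
    exact this
  -- Both sides are analytic, so it suffices to compare Taylor coefficients, which is the recursion
  -- defining `d`.
  · refine (han i).deriv.eventuallyEq_of_iteratedDeriv_eq
      (Finset.analyticAt_fun_sum _ fun j _ => (hA i j).mul (han j)) fun k => ?_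
    rw [← iteratedDeriv_succ', hcoef, iteratedDeriv_fun_sum
      (f := fun j z => A i j z * y j z) fun j _ => ((hA i j).mul (han j)).contDiffAt, hd, linearODESeq, Nat.factorial_succ]
    have hk : (k + 1 : ℂ) ≠ 0 := by exact_mod_cast k.succ_ne_zero
    beta_reduce
    rw [← hd, Fin.sum_univ_eq_sum_range fun l => ∑ j, α i j (k - l) * d l j, Finset.sum_comm]
    push_cast
    rw [mul_comm (k + 1 : ℂ), mul_assoc, mul_div_cancel₀ _ hk, Finset.mul_sum]
    refine Finset.sum_congr rfl fun j _ => ?_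
    -- The Leibniz sum is reversed so that its `l`-th term carries `k - l` derivatives on `A` and
    -- `l` on `y`, as in the recursion.
    rw [iteratedDeriv_fun_mul (hA i j).contDiffAt (han j).contDiffAt, Finset.mul_sum,
      ← Finset.sum_range_reflect]
    refine Finset.sum_congr rfl fun l hl => ?_
    have hl' : l ≤ k := Nat.lt_succ_iff.1 (Finset.mem_range.1 hl)
    have e1 : k + 1 - 1 - l = k - l := by omega
    have e2 : k - (k - l) = l := by omega
    rw [e1, e2, hcoef, hα]
    have h1 : ((k.choose l * l.factorial * (k - l).factorial : ℕ) : ℂ) = k.factorial := by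
      exact_mod_cast Nat.choose_mul_factorial_mul_factorial hl'
    push_cast at h1
    rw [← h1]
    have h2 : ((l.factorial : ℕ) : ℂ) ≠ 0 := by exact_mod_cast l.factorial_ne_zero
    have h3 : (((k - l).factorial : ℕ) : ℂ) ≠ 0 := by exact_mod_cast (k - l).factorial_ne_zero
    rw [← Nat.choose_symm hl']
    field_simp

/-! ### The Euler derivation on functions and local solutions at regular points. -/

lemma Filter.EventuallyEq.eulerFun {f g : ℂ → ℂ} {t : ℂ} (h : f =ᶠ[𝓝 t] g) :
    eulerFun f =ᶠ[𝓝 t] eulerFun g := by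
  filter_upwards [h.deriv] with z hz
  simp only [_root_.eulerFun, hz]

lemma Filter.EventuallyEq.eulerFun_iterate {f g : ℂ → ℂ} {t : ℂ} (h : f =ᶠ[𝓝 t] g) (k : ℕ) :
    _root_.eulerFun^[k] f =ᶠ[𝓝 t] _root_.eulerFun^[k] g := by
  induction k with
  | zero => exact h
  | succ k ih =>
    rw [Function.iterate_succ_apply', Function.iterate_succ_apply']
    exact ih.eulerFun

lemma AnalyticAt.eulerFun {f : ℂ → ℂ} {t : ℂ} (h : AnalyticAt ℂ f t) :
    AnalyticAt ℂ (eulerFun f) t :=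
  analyticAt_id.mul h.deriv

lemma AnalyticAt.eulerFun_iterate {f : ℂ → ℂ} {t : ℂ} (h : AnalyticAt ℂ f t) (k : ℕ) :
    AnalyticAt ℂ (_root_.eulerFun^[k] f) t := by
  induction k with
  | zero => exact h
  | succ k ih =>
    rw [Function.iterate_succ_apply']
    exact ih.eulerFun

lemma eulerFun_iterate_sum {ι : Type*} [Fintype ι] {v : ι → ℂ → ℂ} {t : ℂ}
    (hv : ∀ j, AnalyticAt ℂ (v j) t) (c : ι → ℂ) (k : ℕ) :
    eulerFun^[k] (fun z => ∑ j, c j * v j z) =ᶠ[𝓝 t] fun z => ∑ j, c j * (eulerFun^[k] (v j)) z := by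
  induction k with
  | zero => rfl
  | succ k ih =>
    simp only [Function.iterate_succ_apply']
    refine ih.eulerFun.trans ?_
    have h := fun j => ((hv j).eulerFun_iterate k).eventually_analyticAt
    filter_upwards [eventually_all.2 h] with z hz
    simp only [eulerFun]
    rw [deriv_fun_sum fun j _ => ((hz j).differentiableAt.const_mul _), Finset.mul_sum]
    refine Finset.sum_congr rfl fun j _ => ?_
    rw [deriv_const_mul _ (hz j).differentiableAt]
    ring

namespace HolOp

/-- A linear equation with holomorphic coefficients has holomorphic solutions with arbitrary
initial values at any point where it has no singularity. -/
lemma exists_isLocalSolution {n : ℕ} {a : ℕ → ℂ → ℂ} {t₀ : ℂ} (ht₀ : t₀ ≠ 0)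
    (ha : ∀ k ≤ n, AnalyticAt ℂ (a k) t₀) (hn : a n t₀ ≠ 0) (y₀ : Fin n → ℂ) :
    ∃ u, IsLocalSolution n a t₀ u ∧ ∀ i : Fin n, (eulerFun^[i] u) t₀ = y₀ i := by
  cases n with
  | zero => exact ⟨fun _ => 0, ⟨analyticAt_const, by simp⟩, fun i => i.elim0⟩
  | succ m =>
    -- The companion system for `y i = ε ^ i u`; the factor `z⁻¹` converts `ε` into `d/dz`.
    set A : Fin (m + 1) → Fin (m + 1) → ℂ → ℂ := fun i j z =>
      z⁻¹ * if (i : ℕ) < m then (if (j : ℕ) = i + 1 then 1 else 0) else -(a j z / a (m + 1) z)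
      with hAdef
    have hA (i j) : AnalyticAt ℂ (A i j) t₀ := by
      refine (analyticAt_inv ht₀).mul ?_
      split_ifs with h1 h2
      · exact analyticAt_const
      · exact analyticAt_const
      · exact ((ha j (by omega)).div (ha _ le_rfl) hn).neg
    obtain ⟨y, hy, hy0, hyd⟩ := exists_analyticAt_deriv_eq_sum hA y₀
    have hstep (i : Fin (m + 1)) (hi : (i : ℕ) < m) :
        eulerFun (y i) =ᶠ[𝓝 t₀] y ⟨i + 1, by omega⟩ := by
      filter_upwards [hyd i, continuousAt_id.eventually_ne ht₀] with z hz hz0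
      rw [eulerFun, hz, Finset.sum_eq_single_of_mem (⟨i + 1, by omega⟩ : Fin (m + 1))
        (Finset.mem_univ _)]
      · simp only [hAdef, if_pos hi, if_true, mul_one]
        rw [mul_inv_cancel_left₀ (show z ≠ 0 from hz0)]
      · intro j _ hj
        have hj' : (j : ℕ) ≠ i + 1 := fun h => hj (Fin.ext h)
        simp [hAdef, hi, hj']
    have hlast : eulerFun (y ⟨m, by omega⟩) =ᶠ[𝓝 t₀]
        fun z => ∑ j : Fin (m + 1), -(a j z / a (m + 1) z) * y j z := by
      filter_upwards [hyd ⟨m, by omega⟩, continuousAt_id.eventually_ne ht₀] with z hz hz0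
      rw [eulerFun, hz, Finset.mul_sum]
      refine Finset.sum_congr rfl fun j _ => ?_
      simp only [hAdef, lt_irrefl, if_false]
      rw [mul_assoc, mul_inv_cancel_left₀ (show z ≠ 0 from hz0)]
    have hiter (i : ℕ) (hi : i < m + 1) : eulerFun^[i] (y 0) =ᶠ[𝓝 t₀] y ⟨i, hi⟩ := by
      induction i with
      | zero => rfl
      | succ i ih =>
        rw [Function.iterate_succ_apply']
        exact (ih (by omega)).eulerFun.trans (hstep ⟨i, by omega⟩ (by simp only; omega))
    refine ⟨y 0, ⟨hy 0, ?_⟩, fun i => (hiter i i.2).eq_of_nhds.trans (hy0 i)⟩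
    have hall : ∀ᶠ t in 𝓝 t₀, ∀ i : Fin (m + 1), (eulerFun^[i] (y 0)) t = y i t :=
      eventually_all.2 fun i => hiter i i.2
    have htop : eulerFun^[m + 1] (y 0) =ᶠ[𝓝 t₀]
        fun z => ∑ j : Fin (m + 1), -(a j z / a (m + 1) z) * y j z := by
      rw [Function.iterate_succ_apply']
      exact (hiter m (by omega)).eulerFun.trans hlast
    filter_upwards [hall, htop, (ha _ le_rfl).continuousAt.eventually_ne hn] with t h1 h2 h3
    rw [Finset.sum_range_succ, h2, ← Fin.sum_univ_eq_sum_range fun k =>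
      a k t * (eulerFun^[k] (y 0)) t, Finset.mul_sum, ← Finset.sum_add_distrib]
    refine Finset.sum_eq_zero fun j _ => ?_
    rw [h1]
    field_simp
    ring

end HolOp

/-! ### Exponents of meromorphic solutions. -/

/-- The punctured disk is the exponential image of a half-plane. Connectedness lets the identity
theorem transport relations between `t₀` and the origin. -/
lemma isPreconnected_ball_diff_zero (δ : ℝ) : IsPreconnected (Metric.ball (0 : ℂ) δ \ {0}) := by
  by_cases hδ : 0 < δ
  · have h : Metric.ball (0 : ℂ) δ \ {0} = Complex.exp '' {z | z.re < Real.log δ} := by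
      ext t
      simp only [Set.mem_sdiff, mem_ball_zero_iff, Set.mem_singleton_iff, Set.mem_image,
        Set.mem_ofPred_eq]
      constructor
      · rintro ⟨h1, h2⟩
        refine ⟨Complex.log t, ?_, Complex.exp_log h2⟩
        rw [Complex.log_re]
        exact Real.log_lt_log (norm_pos_iff.2 h2) h1
      · rintro ⟨z, hz, rfl⟩
        refine ⟨?_, Complex.exp_ne_zero z⟩
        rw [Complex.norm_exp]
        exact (Real.lt_log_iff_exp_lt hδ).1 hz
    rw [h]
    exact (convex_halfSpace_re_lt _).isPreconnected.image _ Complex.continuous_exp.continuousOn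
  · rw [Metric.ball_eq_empty.2 (not_lt.1 hδ), Set.empty_sdiff]
    exact isPreconnected_empty

/-- Linearly independent holomorphic germs have as many combinations of distinct orders. -/
lemma exists_injective_analyticOrderAt {n : ℕ} {w : Fin n → ℂ → ℂ}
    (hw : ∀ j, AnalyticAt ℂ (w j) 0)
    (hind : ∀ c : Fin n → ℂ, (∀ᶠ t in 𝓝 0, ∑ j, c j * w j t = 0) → c = 0) :
    ∃ m : Fin n → ℕ, Function.Injective m ∧ ∀ i, ∃ c : Fin n → ℂ,
      analyticOrderAt (fun t => ∑ j, c j * w j t) 0 = m i := by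
  set F : (Fin n → ℂ) → ℂ → ℂ := fun c t => ∑ j, c j * w j t with hF
  have hFa (c) : AnalyticAt ℂ (F c) 0 :=
    Finset.analyticAt_fun_sum _ fun j _ => analyticAt_const.mul (hw j)
  have hFk (c) (k : ℕ) : iteratedDeriv k (F c) 0 = ∑ j, c j * iteratedDeriv k (w j) 0 := by
    rw [hF, iteratedDeriv_fun_sum (f := fun j t => c j * w j t) fun j _ =>
      (analyticAt_const.mul (hw j)).contDiffAt]
    exact Finset.sum_congr rfl fun j _ => iteratedDeriv_const_mul_field _ _
  set S : Set ℕ := {m | ∃ c, analyticOrderAt (F c) 0 = m} with hS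
  suffices h : ∃ s : Finset ℕ, (s : Set ℕ) ⊆ S ∧ s.card = n by
    obtain ⟨s, hsS, hs⟩ := h
    refine ⟨fun i => s.orderIsoOfFin hs i, fun i j hij => ?_, fun i => ?_⟩
    · exact (s.orderIsoOfFin hs).injective (Subtype.ext hij)
    · exact hsS (s.orderIsoOfFin hs i).2
  by_cases hfin : S.Finite
  swap
  · exact Set.Infinite.exists_subset_card_eq hfin n
  lift S to Finset ℕ using hfin with T hT
  -- With fewer than `n` orders, some nonzero combination has vanishing `k`-th derivative at `0` for
  -- every `k ∈ T`. Its own order `m` belongs to `T`, yet its `m`-th derivative must be nonzero.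
  have hn : n ≤ T.card := by
    by_contra! hlt
    let φ : (Fin n → ℂ) →ₗ[ℂ] (T → ℂ) :=
      { toFun := fun c k => ∑ j, c j * iteratedDeriv (k : ℕ) (w j) 0
        map_add' := fun c d => by
          ext k
          simp [add_mul, Finset.sum_add_distrib]
        map_smul' := fun r c => by
          ext k
          simp [Finset.mul_sum, mul_assoc] }
    have hker : LinearMap.ker φ ≠ ⊥ := LinearMap.ker_ne_bot_of_finrank_lt (by simpa using hlt)
    obtain ⟨c, hc, hc0⟩ := (Submodule.ne_bot_iff _).1 hker
    have hne : analyticOrderAt (F c) 0 ≠ ⊤ := by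
      rw [Ne, analyticOrderAt_eq_top]
      exact fun h => hc0 (hind c h)
    obtain ⟨m, hm⟩ := ENat.ne_top_iff_exists.1 hne
    have hmT : m ∈ T := by
      rw [← Finset.mem_coe, hT]
      exact ⟨c, hm.symm⟩
    refine ((analyticOrderAt_eq_nat_iff_iteratedDeriv_eq_zero (hFa c)).1 hm.symm).2 ?_
    rw [hFk]
    exact congrFun (LinearMap.mem_ker.1 hc) ⟨m, hmT⟩
  obtain ⟨s, hsT, hs⟩ := Finset.exists_subset_card_eq hn
  exact ⟨s, by exact_mod_cast hsT, hs⟩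

/-- The function-level version of `HolGerm.twist`. -/
def twistFun (c : ℂ) (g : ℂ → ℂ) : ℂ → ℂ := fun t => eulerFun g t + c * g t

lemma AnalyticAt.twistFun_iterate {g : ℂ → ℂ} {t : ℂ} (hg : AnalyticAt ℂ g t) (c : ℂ) (k : ℕ) :
    AnalyticAt ℂ ((twistFun c)^[k] g) t := by
  induction k with
  | zero => exact hg
  | succ k ih =>
    rw [Function.iterate_succ_apply']
    exact ih.eulerFun.add (analyticAt_const.mul ih)

lemma HolGerm.twist_iterate_mk (c : ℂ) {g : ℂ → ℂ} (hg : AnalyticAt ℂ g 0) (k : ℕ) :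
    (HolGerm.twist c)^[k] (HolGerm.mk g hg) =
      HolGerm.mk ((twistFun c)^[k] g) (hg.twistFun_iterate c k) := by
  induction k with
  | zero => rfl
  | succ k ih =>
    rw [Function.iterate_succ_apply', ih]
    refine HolGerm.mk_eq_mk (f := twistFun c ((twistFun c)^[k] g))
      (hf := (hg.twistFun_iterate c k).twistFun_iterate c 1) |>.2 ?_
    rw [Function.iterate_succ_apply']

lemma HolGerm.sum_mk {ι : Type*} (s : Finset ι) {f : ι → ℂ → ℂ}
    (hf : ∀ i, AnalyticAt ℂ (f i) 0) :
    ∑ i ∈ s, HolGerm.mk (f i) (hf i) =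
      HolGerm.mk (fun t => ∑ i ∈ s, f i t) (Finset.analyticAt_fun_sum _ fun i _ => hf i) := by
  classical
  induction s using Finset.induction_on with
  | empty => rfl
  | insert i s hi ih =>
    rw [Finset.sum_insert hi, ih]
    refine HolGerm.mk_eq_mk (f := fun t => f i t + ∑ j ∈ s, f j t)
      (hf := (hf i).add (Finset.analyticAt_fun_sum _ fun j _ => hf j)) |>.2 ?_
    exact Eventually.of_forall fun t => by simp only [Finset.sum_insert hi]

/-- This is `ε (t ^ l * g) = t ^ l * (ε + l) g`, iterated. It is stated off the origin, where `t ^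
l` is differentiable for negative `l` too. -/
lemma eulerFun_iterate_zpow_mul {f g : ℂ → ℂ} {l : ℤ} (hg : AnalyticAt ℂ g 0)
    (h : f =ᶠ[𝓝[≠] 0] fun t => t ^ l * g t) (k : ℕ) :
    eulerFun^[k] f =ᶠ[𝓝[≠] 0] fun t => t ^ l * ((twistFun l)^[k] g) t := by
  induction k with
  | zero => exact h
  | succ k ih =>
    simp only [Function.iterate_succ_apply']
    have h1 := (hg.twistFun_iterate l k).eventually_analyticAt.filter_mono
      (nhdsWithin_le_nhds (s := {0}ᶜ))
    filter_upwards [ih.nhdsNE_deriv, h1, self_mem_nhdsWithin] with t h2 h3 ht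
    have ht : t ≠ 0 := ht
    have hd := (hasDerivAt_zpow l t (Or.inl ht)).mul h3.differentiableAt.hasDerivAt
    have hd' : deriv (fun t => t ^ l * ((twistFun l)^[k] g) t) t = _ := hd.deriv
    rw [eulerFun, h2, hd', twistFun, eulerFun, zpow_sub_one₀ ht]
    field_simp
    ring

namespace HolOp

open HolGerm

/-- Off the origin the nonzero factor `t ^ l` can be cancelled from the equation. What remains is
analytic at `0`, hence vanishes as a germ. -/
lemma twistAct_mk_eq_zero {L : HolOp} {δ : ℝ} (hδ : 0 < δ) {a : ℕ → ℂ → ℂ}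
    (ha : Represents L δ a) {f g : ℂ → ℂ} {l : ℤ} (hg : AnalyticAt ℂ g 0)
    (hfg : f =ᶠ[𝓝[≠] 0] fun t => t ^ l * g t)
    (hf : ∀ᶠ t in 𝓝[≠] 0,
      ∑ k ∈ Finset.range (L.natDegree + 1), a k t * (eulerFun^[k] f) t = 0) :
    twistAct l L (mk g hg) = 0 := by
  have hk (k : Fin (L.natDegree + 1)) : AnalyticAt ℂ (a k) 0 :=
    (ha.1 k (by omega)).1 0 (Metric.mem_ball_self hδ)
  have h1 : twistAct l L (mk g hg) = ∑ k : Fin (L.natDegree + 1),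
      mk (fun t => a k t * ((twistFun l)^[k] g) t) ((hk k).mul (hg.twistFun_iterate l k)) := by
    rw [twistAct, sum_over_range _ (by simp), ← Fin.sum_univ_eq_sum_range
      fun k => L.coeff k * (twist l)^[k] (mk g hg)]
    refine Finset.sum_congr rfl fun k _ => ?_
    have hc : L.coeff k = mk (a k) (hk k) := Subtype.ext (ha.1 k (by omega)).2.symm
    rw [hc, twist_iterate_mk]
    rfl
  rw [h1, sum_mk]
  refine mk_eq_mk (g := fun _ => 0) (hg := analyticAt_const) |>.2 ?_
  have han : AnalyticAt ℂ
      (fun t => ∑ k : Fin (L.natDegree + 1), a k t * ((twistFun l)^[k] g) t) 0 :=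
    Finset.analyticAt_fun_sum _ fun k _ => (hk k).mul (hg.twistFun_iterate l k)
  refine han.frequently_zero_iff_eventually_zero.1 (Eventually.frequently ?_)
  have h2 := fun k : Fin (L.natDegree + 1) => eulerFun_iterate_zpow_mul hg hfg k
  filter_upwards [hf, eventually_all.2 h2, self_mem_nhdsWithin] with t h3 h4 ht
  rw [← Fin.sum_univ_eq_sum_range fun k => a k t * (eulerFun^[k] f) t] at h3
  refine (mul_eq_zero.1 ?_).resolve_left (zpow_ne_zero l ht)
  rw [Finset.mul_sum]
  refine Eq.trans (Finset.sum_congr rfl fun k _ => ?_) h3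
  rw [h4]
  ring

lemma IsLocalSolution.congr {n : ℕ} {a : ℕ → ℂ → ℂ} {t₀ : ℂ} {u v : ℂ → ℂ}
    (hu : IsLocalSolution n a t₀ u) (h : u =ᶠ[𝓝 t₀] v) : IsLocalSolution n a t₀ v := by
  refine ⟨hu.1.congr h, ?_⟩
  have h1 := fun k : Fin (n + 1) => h.eulerFun_iterate k
  filter_upwards [hu.2, eventually_all.2 h1] with t h2 h3
  rw [← h2]
  refine Finset.sum_congr rfl fun k hk => ?_
  have := h3 ⟨k, Finset.mem_range.1 hk⟩
  rw [← this]

/-- A full set of independent solutions with poles of order at most `N` provides solutions with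
distinct exponents. -/
lemma exists_exponents {L : HolOp} {δ : ℝ} (hδ : 0 < δ) {a : ℕ → ℂ → ℂ}
    (ha : Represents L δ a) {v w : Fin L.natDegree → ℂ → ℂ} {t₀ : ℂ}
    (ht₀ : t₀ ∈ Metric.ball (0 : ℂ) δ \ {0})
    (hv : ∀ j, AnalyticOnNhd ℂ (v j) (Metric.ball 0 δ \ {0}))
    (hsol : ∀ j, IsLocalSolution L.natDegree a t₀ (v j))
    (hinit : ∀ j i : Fin L.natDegree, (eulerFun^[i] (v j)) t₀ = if j = i then 1 else 0)
    (N : ℕ) (hw : ∀ j, AnalyticAt ℂ (w j) 0)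
    (hwv : ∀ j, w j =ᶠ[𝓝[≠] 0] fun t => t ^ N * v j t) :
    ∃ l : Fin L.natDegree → ℤ, Function.Injective l ∧ (∀ i, -(N : ℤ) ≤ l i) ∧
      ∃ g : Fin L.natDegree → HolGerm, (∀ i, value (g i) ≠ 0) ∧
        ∀ i, twistAct (l i) L (g i) = 0 := by
  have hpre := isPreconnected_ball_diff_zero δ
  have hnhds : ∀ᶠ t in 𝓝[≠] (0 : ℂ), t ∈ Metric.ball (0 : ℂ) δ \ {0} := by
    filter_upwards [nhdsWithin_le_nhds (Metric.ball_mem_nhds (0 : ℂ) hδ), self_mem_nhdsWithin]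
      with t h1 h2 using ⟨h1, h2⟩
  set F : (Fin L.natDegree → ℂ) → ℂ → ℂ := fun c t => ∑ j, c j * v j t with hF
  have hFa (c) : AnalyticOnNhd ℂ (F c) (Metric.ball 0 δ \ {0}) := fun t ht =>
    Finset.analyticAt_fun_sum _ fun j _ => analyticAt_const.mul (hv j t ht)
  -- Vanishing near `0` spreads to `t₀` by the identity theorem, where the initial data of the
  -- combination are the coefficients `c` themselves.
  have hFind (c) (h : ∀ᶠ t in 𝓝[≠] 0, F c t = 0) : c = 0 := by
    obtain ⟨t₁, h1, ht₁⟩ := (eventually_eventually_nhdsWithin.2 h |>.and hnhds).exists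
    rw [(isOpen_compl_singleton).nhdsWithin_eq ht₁.2] at h1
    have hzero := (hFa c).eqOn_zero_of_preconnected_of_eventuallyEq_zero hpre ht₁ h1
    have hopen : IsOpen (Metric.ball (0 : ℂ) δ \ {0}) :=
      Metric.isOpen_ball.sdiff isClosed_singleton
    have h2 : F c =ᶠ[𝓝 t₀] fun _ => 0 := hzero.eventuallyEq_of_mem (hopen.mem_nhds ht₀)
    ext1 i
    have h3 := (h2.eulerFun_iterate i).eq_of_nhds
    have h4 := (eulerFun_iterate_sum (fun j => hv j t₀ ht₀) c i).eq_of_nhds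
    have h5 (k : ℕ) : eulerFun^[k] (fun _ => 0) = fun _ => 0 :=
      Function.iterate_fixed (by funext t; simp [eulerFun]) k
    rw [h5] at h3
    have h6 := h4.symm.trans h3
    simpa [hinit] using h6
  -- The opposite transport: the equation holds near `t₀` by linearity, hence on the whole punctured
  -- disk.
  have hFsol (c) : ∀ᶠ t in 𝓝[≠] 0,
      ∑ k ∈ Finset.range (L.natDegree + 1), a k t * (eulerFun^[k] (F c)) t = 0 := by
    have hA : AnalyticOnNhd ℂ (fun t => ∑ k ∈ Finset.range (L.natDegree + 1),
        a k t * (eulerFun^[k] (F c)) t) (Metric.ball 0 δ \ {0}) := fun t ht =>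
      Finset.analyticAt_fun_sum _ fun k hk =>
        ((ha.1 k (by have := Finset.mem_range.1 hk; omega)).1 t ht.1).mul
          ((hFa c t ht).eulerFun_iterate k)
    refine hnhds.mono fun t ht => hA.eqOn_zero_of_preconnected_of_eventuallyEq_zero hpre ht₀ ?_ ht
    have h1 := fun k : Fin (L.natDegree + 1) =>
      eulerFun_iterate_sum (fun j => hv j t₀ ht₀) c k
    filter_upwards [eventually_all.2 h1, eventually_all.2 fun j => (hsol j).2] with t h2 h3
    calc _ = ∑ k ∈ Finset.range (L.natDegree + 1), ∑ j,
          c j * (a k t * (eulerFun^[k] (v j)) t) := by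
          refine Finset.sum_congr rfl fun k hk => ?_
          have h4 := h2 ⟨k, Finset.mem_range.1 hk⟩
          simp only at h4
          rw [hF, h4, Finset.mul_sum]
          exact Finset.sum_congr rfl fun j _ => by ring
      _ = 0 := by
          rw [Finset.sum_comm]
          refine Finset.sum_eq_zero fun j _ => ?_
          rw [← Finset.mul_sum, h3, mul_zero]
  have hwF (c : Fin L.natDegree → ℂ) :
      ∀ᶠ t in 𝓝[≠] 0, ∑ j, c j * w j t = t ^ N * F c t := by
    filter_upwards [eventually_all.2 hwv] with t ht
    rw [hF, Finset.mul_sum]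
    refine Finset.sum_congr rfl fun j _ => ?_
    rw [ht]
    ring
  obtain ⟨m, hm, hmc⟩ := exists_injective_analyticOrderAt hw fun c hc => hFind c (by
    filter_upwards [hwF c, nhdsWithin_le_nhds hc, self_mem_nhdsWithin] with t h1 h2 h3
    rw [h1] at h2
    exact (mul_eq_zero.1 h2).resolve_left (pow_ne_zero N h3))
  choose c hc using hmc
  have hfac (i) := (Finset.analyticAt_fun_sum Finset.univ fun j _ =>
    (analyticAt_const (v := c i j)).mul (hw j)).analyticOrderAt_eq_natCast.1 (hc i)
  choose g hga hg0 hg using hfac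
  -- Undoing the multiplication by `t ^ N` that removed the poles.
  refine ⟨fun i => m i - N, fun i j hij => hm (by simpa using hij), fun i => by simp,
    fun i => mk (g i) (hga i), hg0, fun i => ?_⟩
  refine twistAct_mk_eq_zero hδ ha (hga i) (f := F (c i)) ?_ (hFsol (c i))
  filter_upwards [hwF (c i), nhdsWithin_le_nhds (hg i), self_mem_nhdsWithin] with t h1 h2 h3
  have h3 : t ≠ 0 := h3
  simp only [Pi.mul_apply, sub_zero, smul_eq_mul] at h2
  rw [h1] at h2
  rw [zpow_sub₀ h3, zpow_natCast, zpow_natCast]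
  field_simp
  rw [mul_comm, h2]

lemma exists_initial_solutions {L : HolOp} {δ : ℝ} (hδ : 0 < δ) {a : ℕ → ℂ → ℂ}
    (ha : Represents L δ a) :
    ∃ t₀ ∈ Metric.ball (0 : ℂ) δ, t₀ ≠ 0 ∧ ∃ u : Fin L.natDegree → ℂ → ℂ,
      (∀ j, IsLocalSolution L.natDegree a t₀ (u j)) ∧
      ∀ j i : Fin L.natDegree, (eulerFun^[i] (u j)) t₀ = if j = i then 1 else 0 := by
  have hmem : ((δ / 2 : ℝ) : ℂ) ∈ Metric.ball (0 : ℂ) δ := by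
    rw [mem_ball_zero_iff, Complex.norm_real, Real.norm_of_nonneg (by positivity)]
    exact half_lt_self hδ
  have hne : ((δ / 2 : ℝ) : ℂ) ≠ 0 := by exact_mod_cast (half_pos hδ).ne'
  have h (j : Fin L.natDegree) := exists_isLocalSolution hne (fun k hk => (ha.1 k hk).1 _ hmem)
    (ha.2 _ hmem) fun i => if j = i then 1 else 0
  choose u hu hu0 using h
  exact ⟨_, hmem, hne, u, hu, hu0⟩

theorem OnlyMeromorphicSolutions.exists_fEquiv {L : HolOp} (hL : IsFuchsian L)
    (h : OnlyMeromorphicSolutions L) : ∃ l : Fin L.natDegree → ℤ, Function.Injective l ∧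
      FEquiv L (ofEuler (∏ i, (X - C ((l i : ℤ) : ℂ)))) := by
  obtain ⟨δ, hδ, a, ha, h⟩ := h
  obtain ⟨t₀, ht₀, hne, u, hu, hu0⟩ := exists_initial_solutions hδ ha
  choose v hv hvm hvu using fun j => h t₀ ht₀ hne (u j) (hu j)
  choose d hd using hvm
  -- The sum of the individual pole bounds `d j` is a common bound; each `w j` is split so that its
  -- factors are visibly analytic.
  obtain ⟨l, hl, -, g, hg, hg0⟩ := exists_exponents hδ ha ⟨ht₀, hne⟩ hv
    (fun j => (hu j).congr (hvu j).symm)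
    (fun j i => ((hvu j).eulerFun_iterate i).eq_of_nhds.trans (hu0 j i)) (∑ j, d j)
    (w := fun j t => t ^ (∑ j, d j - d j) * ((t - 0) ^ d j • v j t))
    (fun j => (analyticAt_id.pow _).mul (hd j))
    (fun j => Eventually.of_forall fun t => by
      simp only [sub_zero, smul_eq_mul]
      rw [← mul_assoc, ← pow_add, Nat.sub_add_cancel
        (Finset.single_le_sum (fun _ _ => Nat.zero_le _) (Finset.mem_univ j))])
  exact ⟨l, hl, fEquiv_of_twistAct_eq_zero hL (Int.cast_injective.comp hl) hg hg0⟩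

theorem OnlyHolomorphicSolutions.exists_fEquiv {L : HolOp} (hL : IsFuchsian L)
    (h : OnlyHolomorphicSolutions L) : ∃ l : Fin L.natDegree → ℤ, Function.Injective l ∧
      (∀ i, 0 ≤ l i) ∧ FEquiv L (ofEuler (∏ i, (X - C ((l i : ℤ) : ℂ)))) := by
  obtain ⟨δ, hδ, a, ha, h⟩ := h
  obtain ⟨t₀, ht₀, hne, u, hu, hu0⟩ := exists_initial_solutions hδ ha
  choose v hv hvu using fun j => h t₀ ht₀ hne (u j) (hu j)
  -- There are no poles to clear, so `N = 0`, and the lower bound `-N` on the exponents gives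
  -- nonnegativity.
  obtain ⟨l, hl, hl0, g, hg, hg0⟩ := exists_exponents hδ ha ⟨ht₀, hne⟩
    (fun j => (hv j).mono Set.sdiff_subset) (fun j => (hu j).congr (hvu j).symm)
    (fun j i => ((hvu j).eulerFun_iterate i).eq_of_nhds.trans (hu0 j i)) 0
    (fun j => hv j 0 (Metric.mem_ball_self hδ)) (fun j => Eventually.of_forall fun t => by simp)
  exact ⟨l, hl, by simpa using hl0,
    fEquiv_of_twistAct_eq_zero hL (Int.cast_injective.comp hl) hg hg0⟩

end HolOp

/-! ### Operators acting on functions through representatives of germs. -/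

namespace HolGerm

/-- A function representing a germ. -/
def rep (g : HolGerm) : ℂ → ℂ := (exists_eq_mk g).choose

lemma analyticAt_rep (g : HolGerm) : AnalyticAt ℂ (rep g) 0 := (exists_eq_mk g).choose_spec.choose

lemma mk_rep (g : HolGerm) : mk (rep g) (analyticAt_rep g) = g :=
  (exists_eq_mk g).choose_spec.choose_spec.symm

lemma rep_mk {f : ℂ → ℂ} (hf : AnalyticAt ℂ f 0) : rep (mk f hf) =ᶠ[𝓝 0] f :=
  mk_eq_mk.1 (mk_rep (mk f hf))

lemma rep_const (c : ℂ) : rep (const c) =ᶠ[𝓝 0] fun _ => c := rep_mk (f := fun _ => c) analyticAt_const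

lemma rep_zero : rep 0 =ᶠ[𝓝 0] fun _ => 0 := rep_mk (f := fun _ => 0) analyticAt_const

lemma rep_one : rep 1 =ᶠ[𝓝 0] fun _ => 1 := rep_mk (f := fun _ => 1) analyticAt_const

lemma rep_add (g h : HolGerm) : rep (g + h) =ᶠ[𝓝 0] fun t => rep g t + rep h t := by
  have := rep_mk ((analyticAt_rep g).add (analyticAt_rep h))
  rwa [show mk _ ((analyticAt_rep g).add (analyticAt_rep h)) = g + h from
    congrArg₂ (· + ·) (mk_rep g) (mk_rep h)] at this

lemma rep_mul (g h : HolGerm) : rep (g * h) =ᶠ[𝓝 0] fun t => rep g t * rep h t := by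
  have := rep_mk ((analyticAt_rep g).mul (analyticAt_rep h))
  rwa [show mk _ ((analyticAt_rep g).mul (analyticAt_rep h)) = g * h from
    congrArg₂ (· * ·) (mk_rep g) (mk_rep h)] at this

lemma rep_deriv (g : HolGerm) : rep (Differential.deriv g) =ᶠ[𝓝 0] eulerFun (rep g) := by
  have := rep_mk (analyticAt_rep g).eulerFun
  rwa [show mk _ (analyticAt_rep g).eulerFun = Differential.deriv g from
    congrArg Differential.deriv (mk_rep g)] at this

lemma rep_zero_eq_value (g : HolGerm) : rep g 0 = value g := by
  conv_rhs => rw [← mk_rep g]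
  rfl

end HolGerm

namespace HolOp

open HolGerm

/-- The action of an operator on functions, through representatives of its coefficients. -/
def funAct (P : HolOp) (u : ℂ → ℂ) (t : ℂ) : ℂ := P.sum fun k a => rep a t * (eulerFun^[k] u) t

/-- Even the representative of the zero germ is zero only near the origin, so the algebraic rules
hold only there. In this and the following rules the neighbourhood is chosen before `u`, so that one
disk serves all local solutions. -/
lemma eventually_funAct_eq_sum_range (P : HolOp) {n : ℕ} (hn : P.natDegree < n) :
    ∀ᶠ t in 𝓝 0, ∀ u, funAct P u t =
      ∑ k ∈ Finset.range n, rep (P.coeff k) t * (eulerFun^[k] u) t := by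
  filter_upwards [rep_zero] with t ht u
  exact sum_over_range' _ (by simp [ht]) _ hn

lemma eventually_analyticAt_rep_coeff (P : HolOp) :
    ∀ᶠ t in 𝓝 0, ∀ k ∈ P.support, AnalyticAt ℂ (rep (P.coeff k)) t :=
  (Filter.eventually_all_finset _).2 fun _ _ => (analyticAt_rep _).eventually_analyticAt

lemma analyticAt_funAct {P : HolOp} {t : ℂ} {u : ℂ → ℂ}
    (hP : ∀ k ∈ P.support, AnalyticAt ℂ (rep (P.coeff k)) t) (hu : AnalyticAt ℂ u t) :
    AnalyticAt ℂ (funAct P u) t :=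
  Finset.analyticAt_fun_sum _ fun k hk => (hP k hk).mul (hu.eulerFun_iterate k)

lemma funAct_congr (P : HolOp) {t : ℂ} {u v : ℂ → ℂ} (h : u =ᶠ[𝓝 t] v) :
    funAct P u =ᶠ[𝓝 t] funAct P v := by
  have h1 := (Filter.eventually_all_finset P.support).2 fun k _ => h.eulerFun_iterate k
  filter_upwards [h1] with z hz
  exact Finset.sum_congr rfl fun k hk => congrArg (rep (P.coeff k) z * ·) (hz k hk)

lemma funAct_zero_right (P : HolOp) (t : ℂ) : funAct P (fun _ => 0) t = 0 := by
  refine Finset.sum_eq_zero fun k _ => ?_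
  have h : eulerFun^[k] (fun _ => 0) = fun _ => 0 :=
    Function.iterate_fixed (by funext t; simp [eulerFun]) k
  beta_reduce
  rw [h, mul_zero]

/-- An identity at points near the origin is an identity of germs at points near the origin. -/
lemma eventually_eventuallyEq {A B : (ℂ → ℂ) → ℂ → ℂ}
    (h : ∀ᶠ t in 𝓝 0, ∀ u, AnalyticAt ℂ u t → A u t = B u t) :
    ∀ᶠ t in 𝓝 0, ∀ u, AnalyticAt ℂ u t → A u =ᶠ[𝓝 t] B u := by
  filter_upwards [eventually_eventually_nhds.2 h] with t ht u hu
  filter_upwards [ht, hu.eventually_analyticAt] with z hz hu using hz u hu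

lemma eventually_funAct_add (P Q : HolOp) :
    ∀ᶠ t in 𝓝 0, ∀ u, funAct (P + Q) u t = funAct P u t + funAct Q u t := by
  set n := max P.natDegree Q.natDegree + 1 with hn
  have hPQ := natDegree_add_le P Q
  have hc := (Filter.eventually_all_finset (Finset.range n)).2
    fun k _ => rep_add (P.coeff k) (Q.coeff k)
  filter_upwards [eventually_funAct_eq_sum_range P (n := n) (by omega),
    eventually_funAct_eq_sum_range Q (n := n) (by omega),
    eventually_funAct_eq_sum_range (P + Q) (n := n) (by omega), hc] with t h1 h2 h3 h4 u
  rw [h1, h2, h3, ← Finset.sum_add_distrib]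
  refine Finset.sum_congr rfl fun k hk => ?_
  rw [coeff_add, h4 k hk]
  ring

lemma eventually_funAct_C_mul (a : HolGerm) (P : HolOp) :
    ∀ᶠ t in 𝓝 0, ∀ u, funAct (C a * P) u t = rep a t * funAct P u t := by
  have hd := natDegree_C_mul_le a P
  have hc := (Filter.eventually_all_finset (Finset.range (P.natDegree + 1))).2
    fun k _ => rep_mul a (P.coeff k)
  filter_upwards [eventually_funAct_eq_sum_range P (Nat.lt_succ_self _),
    eventually_funAct_eq_sum_range (C a * P) (Nat.lt_succ_of_le hd), hc] with t h1 h2 h3 u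
  rw [h1, h2, Finset.mul_sum]
  refine Finset.sum_congr rfl fun k hk => ?_
  rw [coeff_C_mul, h3 k hk]
  ring

lemma eventually_funAct_monomial (k : ℕ) (a : HolGerm) :
    ∀ᶠ t in 𝓝 0, ∀ u, funAct (monomial k a) u t = rep a t * (eulerFun^[k] u) t := by
  filter_upwards [rep_zero] with t ht u
  exact sum_monomial_index _ _ (by simp [ht])

lemma eventually_funAct_one : ∀ᶠ t in 𝓝 0, ∀ u, funAct 1 u t = u t := by
  filter_upwards [eventually_funAct_monomial 0 1, rep_one] with t h1 h2 u
  simpa [h2] using h1 u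

/-- Differentiating needs the rules for `funAct` as identities of germs at `t`, not only at the
point; hence `eventually_eventuallyEq`. -/
lemma eventually_funAct_eulerComp (Q : HolOp) :
    ∀ᶠ t in 𝓝 0, ∀ u, AnalyticAt ℂ u t → funAct (eulerComp Q) u t = eulerFun (funAct Q u) t := by
  induction Q using Polynomial.induction_on' with
  | add P Q hP hQ =>
    have h := eventually_eventuallyEq (A := funAct (P + Q))
      (B := fun u t => funAct P u t + funAct Q u t)
      ((eventually_funAct_add P Q).mono fun t ht u _ => ht u)
    filter_upwards [hP, hQ, h, eventually_funAct_add (eulerComp P) (eulerComp Q),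
      eventually_analyticAt_rep_coeff P, eventually_analyticAt_rep_coeff Q]
      with t h1 h2 h3 h4 h5 h6 u hu
    rw [eulerComp_add, h4, h1 u hu, h2 u hu, (h3 u hu).eulerFun.eq_of_nhds]
    have h7 := (analyticAt_funAct h5 hu).differentiableAt
    have h8 := (analyticAt_funAct h6 hu).differentiableAt
    rw [eulerFun, eulerFun, eulerFun, deriv_fun_add h7 h8, mul_add]
  | monomial k a =>
    have h := eventually_eventuallyEq (A := funAct (monomial k a))
      (B := fun u t => rep a t * (eulerFun^[k] u) t)
      ((eventually_funAct_monomial k a).mono fun t ht u _ => ht u)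
    filter_upwards [h, eventually_funAct_add (monomial (k + 1) a) (monomial k _),
      eventually_funAct_monomial (k + 1) a, eventually_funAct_monomial k _, rep_deriv a,
      (analyticAt_rep a).eventually_analyticAt] with t h1 h2 h3 h4 h5 h6 u hu
    rw [eulerComp_monomial, h2, h3, h4, h5, (h1 u hu).eulerFun.eq_of_nhds,
      Function.iterate_succ_apply', eulerFun, eulerFun, eulerFun,
      deriv_fun_mul h6.differentiableAt (hu.eulerFun_iterate k).differentiableAt]
    ring

lemma eventually_funAct_opComp (P Q : HolOp) :
    ∀ᶠ t in 𝓝 0, ∀ u, AnalyticAt ℂ u t → funAct (opComp P Q) u t = funAct P (funAct Q u) t := by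
  induction P using Polynomial.induction_on' with
  | add P₁ P₂ h₁ h₂ =>
    filter_upwards [h₁, h₂, eventually_funAct_add (opComp P₁ Q) (opComp P₂ Q),
      eventually_funAct_add P₁ P₂] with t h1 h2 h3 h4 u hu
    rw [opComp_add, h3, h4, h1 u hu, h2 u hu]
  | monomial k a =>
    have hk : ∀ᶠ t in 𝓝 0, ∀ u, AnalyticAt ℂ u t →
        funAct (eulerComp^[k] Q) u t = (eulerFun^[k] (funAct Q u)) t := by
      induction k with
      | zero => exact Eventually.of_forall fun t u _ => rfl
      | succ k ih =>
        filter_upwards [eventually_eventuallyEq ih, eventually_funAct_eulerComp (eulerComp^[k] Q)]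
          with t h1 h2 u hu
        rw [Function.iterate_succ_apply', Function.iterate_succ_apply', h2 u hu]
        exact (h1 u hu).eulerFun.eq_of_nhds
    filter_upwards [hk, eventually_funAct_C_mul a (eulerComp^[k] Q),
      eventually_funAct_monomial k a] with t h1 h2 h3 u hu
    rw [opComp_monomial, h2, h3, h1 u hu]

/-! ### Euler equations with simple integer exponents. -/

/-- The action of an Euler operator on functions. -/
def eulerAct (p : ℂ[X]) (u : ℂ → ℂ) (t : ℂ) : ℂ := p.sum fun k c => c * (eulerFun^[k] u) t

lemma eulerAct_add (p q : ℂ[X]) (u : ℂ → ℂ) (t : ℂ) :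
    eulerAct (p + q) u t = eulerAct p u t + eulerAct q u t :=
  sum_add_index _ _ _ (by simp) (by intros; simp [add_mul])

lemma eulerAct_monomial (k : ℕ) (c : ℂ) (u : ℂ → ℂ) (t : ℂ) :
    eulerAct (monomial k c) u t = c * (eulerFun^[k] u) t :=
  sum_monomial_index _ _ (by simp)

lemma eventually_funAct_ofEuler (p : ℂ[X]) :
    ∀ᶠ t in 𝓝 0, ∀ u, funAct (ofEuler p) u t = eulerAct p u t := by
  induction p using Polynomial.induction_on' with
  | add p q hp hq =>
    filter_upwards [hp, hq, eventually_funAct_add (ofEuler p) (ofEuler q)] with t h1 h2 h3 u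
    rw [eulerAct_add, ← h1, ← h2, ← h3, ofEuler, ofEuler, ofEuler, Polynomial.map_add]
  | monomial k c =>
    filter_upwards [eventually_funAct_monomial k (const c), rep_const c] with t h1 h2 u
    rw [eulerAct_monomial, ofEuler, map_monomial, h1, h2]

lemma eulerAct_mul_X_sub_C (p : ℂ[X]) (c : ℂ) {w : ℂ → ℂ} {t : ℂ} (hw : AnalyticAt ℂ w t) :
    eulerAct (p * (X - C c)) w t = eulerAct p (fun z => eulerFun w z - c * w z) t := by
  induction p using Polynomial.induction_on' with
  | add p q hp hq => rw [add_mul, eulerAct_add, eulerAct_add, hp, hq]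
  | monomial k b =>
    have h1 : monomial k b * (X - C c) = monomial (k + 1) b + monomial k (-(b * c)) := by
      rw [mul_sub, monomial_mul_X, monomial_mul_C, sub_eq_add_neg, monomial_neg]
    have h2 := (eulerFun_iterate_sum (v := ![eulerFun w, w])
      (Fin.forall_fin_two.2 ⟨hw.eulerFun, hw⟩) ![1, -c] k).eq_of_nhds
    simp only [Fin.sum_univ_two, Matrix.cons_val_zero, Matrix.cons_val_one, one_mul, neg_mul,
      ← sub_eq_add_neg] at h2
    rw [h1, eulerAct_add, eulerAct_monomial, eulerAct_monomial, eulerAct_monomial, h2,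
      Function.iterate_succ_apply]
    ring

lemma hasDerivAt_sum_zpow {ι : Type*} (s : Finset ι) (l : ι → ℤ) (c : ι → ℂ) {t : ℂ} (ht : t ≠ 0) :
    HasDerivAt (fun t : ℂ => ∑ i ∈ s, c i * t ^ l i) (∑ i ∈ s, c i * (l i * t ^ (l i - 1))) t :=
  HasDerivAt.fun_sum fun i _ => (hasDerivAt_zpow (l i) t (Or.inl ht)).const_mul (c i)

/-- The function `t ^ (-l) * w` has zero derivative on a disk around `t₀` that avoids the origin, so
it is constant. -/
lemma exists_eq_const_mul_zpow {w : ℂ → ℂ} {t₀ : ℂ} (ht₀ : t₀ ≠ 0) (l : ℤ)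
    (hw : AnalyticAt ℂ w t₀) (h : ∀ᶠ t in 𝓝 t₀, eulerFun w t = l * w t) :
    ∃ c : ℂ, w =ᶠ[𝓝 t₀] fun t => c * t ^ l := by
  obtain ⟨r, hr, hball⟩ := Metric.eventually_nhds_iff_ball.1
    (h.and (hw.eventually_analyticAt.and (continuousAt_id.eventually_ne ht₀)))
  have hd (t) (ht : t ∈ Metric.ball t₀ r) : HasDerivAt (fun t => t ^ (-l) * w t) 0 t := by
    obtain ⟨h1, h2, h3⟩ := hball t ht
    have h3 : t ≠ 0 := h3
    have := (hasDerivAt_zpow (-l) t (Or.inl h3)).mul h2.differentiableAt.hasDerivAt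
    convert! this using 1
    rw [eulerFun] at h1
    rw [zpow_sub_one₀ h3]
    field_simp
    rw [h1]
    push_cast
    ring
  refine ⟨t₀ ^ (-l) * w t₀, ?_⟩
  filter_upwards [Metric.ball_mem_nhds t₀ hr] with t ht
  have heq := Metric.isOpen_ball.is_const_of_deriv_eq_zero
    (convex_ball t₀ r).isPreconnected
    (fun z hz => (hd z hz).differentiableAt.differentiableWithinAt)
    (fun z hz => (hd z hz).deriv) (Metric.mem_ball_self hr) ht
  have h3 : t ≠ 0 := (hball t ht).2.2
  beta_reduce at heq
  rw [heq, zpow_neg]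
  field_simp

/-- The solutions of an Euler equation with simple integer exponents. -/
lemma exists_eq_sum_zpow {ι : Type*} (s : Finset ι) {l : ι → ℤ} (hl : Function.Injective l)
    {t₀ : ℂ} (ht₀ : t₀ ≠ 0) {w : ℂ → ℂ} (hw : AnalyticAt ℂ w t₀)
    (h : ∀ᶠ t in 𝓝 t₀, eulerAct (∏ i ∈ s, (X - C ((l i : ℤ) : ℂ))) w t = 0) :
    ∃ c : ι → ℂ, w =ᶠ[𝓝 t₀] fun t => ∑ i ∈ s, c i * t ^ l i := by
  classical
  induction s using Finset.induction_on generalizing w with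
  | empty =>
    refine ⟨0, ?_⟩
    filter_upwards [h] with t ht
    rw [Finset.prod_empty, ← monomial_zero_one, eulerAct_monomial] at ht
    simpa using ht
  | insert j s hj ih =>
    have hw1 : AnalyticAt ℂ (fun z => eulerFun w z - l j * w z) t₀ :=
      hw.eulerFun.sub (analyticAt_const.mul hw)
    obtain ⟨c, hc⟩ := ih hw1 (by
      filter_upwards [h, hw.eventually_analyticAt] with t h1 h2
      rwa [Finset.prod_insert hj, mul_comm, eulerAct_mul_X_sub_C _ _ h2] at h1)
    -- A particular solution of `(ε - l j) w = ∑ c i * t ^ l i`, because `(ε - l j) t ^ l i = (l i -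
    -- l j) t ^ l i`; the exponents being distinct, no logarithm appears. The difference from `w` is
    -- a multiple of `t ^ l j`.
    set d : ι → ℂ := fun i => c i / (l i - l j) with hd
    have hsum : AnalyticAt ℂ (fun t : ℂ => ∑ i ∈ s, d i * t ^ l i) t₀ :=
      Finset.analyticAt_fun_sum _ fun i _ => analyticAt_const.mul (analyticAt_id.zpow ht₀)
    obtain ⟨b, hb⟩ := exists_eq_const_mul_zpow ht₀ (l j) (hw.sub hsum) (by
      filter_upwards [hc, hw.eventually_analyticAt, continuousAt_id.eventually_ne ht₀]
        with t h1 h2 h3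
      have h3 : t ≠ 0 := h3
      have hd1 := hasDerivAt_sum_zpow s l d h3
      rw [eulerFun, deriv_sub h2.differentiableAt hd1.differentiableAt, hd1.deriv, Pi.sub_apply,
        mul_sub, mul_sub, sub_eq_sub_iff_sub_eq_sub, ← eulerFun, h1, Finset.mul_sum,
        Finset.mul_sum, ← Finset.sum_sub_distrib]
      refine Finset.sum_congr rfl fun i hi => ?_
      have hne : (l i : ℂ) - l j ≠ 0 := by
        rw [sub_ne_zero]
        intro h
        exact hj (hl (Int.cast_injective h) ▸ hi)
      rw [hd, zpow_sub_one₀ h3]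
      field_simp)
    refine ⟨fun i => if i = j then b else d i, ?_⟩
    filter_upwards [hb] with t ht
    rw [Pi.sub_apply, sub_eq_iff_eq_add] at ht
    rw [Finset.sum_insert hj, if_pos rfl, ht]
    congr 1
    refine Finset.sum_congr rfl fun i hi => ?_
    rw [if_neg (ne_of_mem_of_not_mem hi hj)]

/-! ### From equivalence to the shape of the solutions. -/

/-- The solutions of an equation which is equivalent to an Euler equation with simple integer
exponents are the images of the solutions of the latter under an operator. -/
lemma FEquiv.exists_solutions_eq {L : HolOp} {n : ℕ} {l : Fin n → ℤ} (hl : Function.Injective l)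
    (h : FEquiv L (ofEuler (∏ i, (X - C ((l i : ℤ) : ℂ))))) :
    ∃ δ > 0, ∃ (a : ℕ → ℂ → ℂ) (U : HolOp), Represents L δ a ∧
      (∀ t ∈ Metric.ball (0 : ℂ) δ, ∀ k ∈ U.support, AnalyticAt ℂ (rep (U.coeff k)) t) ∧
      ∀ t₀ ∈ Metric.ball (0 : ℂ) δ, t₀ ≠ 0 → ∀ u : ℂ → ℂ, IsLocalSolution L.natDegree a t₀ u →
        ∃ c : Fin n → ℂ, funAct U (fun t => ∑ i, c i * t ^ l i) =ᶠ[𝓝 t₀] u := by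
  obtain ⟨hL, hM, -, H, K, hH, hK, hMH, hco⟩ := h
  obtain ⟨U, V, hUV⟩ := exists_opComp_add_eq_one hH hL hco
  set M := ofEuler (∏ i, (X - C ((l i : ℤ) : ℂ))) with hMdef
  have hlead : ∀ᶠ t in 𝓝 0, rep (L.coeff L.natDegree) t ≠ 0 :=
    (analyticAt_rep _).continuousAt.eventually_ne (by rw [rep_zero_eq_value]; exact hL)
  have hLa : ∀ᶠ t in 𝓝 0, ∀ k ∈ Finset.range (L.natDegree + 1),
      AnalyticAt ℂ (rep (L.coeff k)) t :=
    (Filter.eventually_all_finset _).2 fun k _ => (analyticAt_rep _).eventually_analyticAt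
  -- Where `L u = 0`, the identity `U H + V L = 1` recovers `u` from `H u`, and `M H = K L` makes `H
  -- u` a solution of the Euler equation.
  have key : ∀ᶠ t in 𝓝 0, ∀ u, AnalyticAt ℂ u t → funAct L u =ᶠ[𝓝 t] (fun _ => 0) →
      u =ᶠ[𝓝 t] funAct U (funAct H u) ∧
      ∀ᶠ z in 𝓝 t, eulerAct (∏ i, (X - C ((l i : ℤ) : ℂ))) (funAct H u) z = 0 := by
    have h0 := (eventually_funAct_opComp U H).and ((eventually_funAct_opComp V L).and
      ((eventually_funAct_opComp M H).and ((eventually_funAct_opComp K L).and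
      ((eventually_funAct_add (opComp U H) (opComp V L)).and
      (eventually_funAct_one.and (eventually_funAct_ofEuler (∏ i, (X - C ((l i : ℤ) : ℂ)))))))))
    filter_upwards [eventually_eventually_nhds.2 h0] with t ht u hu hLu
    have hboth : ∀ᶠ z in 𝓝 t, u z = funAct U (funAct H u) z ∧
        eulerAct (∏ i, (X - C ((l i : ℤ) : ℂ))) (funAct H u) z = 0 := by
      filter_upwards [ht, hu.eventually_analyticAt, eventually_eventually_nhds.2 hLu]
        with z ⟨h1, h2, h3, h4, h5, h6, h7⟩ hz hLz
      have hzero (P : HolOp) : funAct P (funAct L u) z = 0 :=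
        ((funAct_congr P hLz).eq_of_nhds).trans (funAct_zero_right P z)
      constructor
      · rw [← h6 u, ← hUV, h5, h1 u hz, h2 u hz, hzero, add_zero]
      · rw [← h7 (funAct H u), ← hMdef, ← h3 u hz, hMH, h4 u hz, hzero]
    exact ⟨hboth.mono fun z hz => hz.1, hboth.mono fun z hz => hz.2⟩
  obtain ⟨δ, hδ, hball⟩ := Metric.eventually_nhds_iff_ball.1 (key.and (hlead.and (hLa.and
    ((eventually_analyticAt_rep_coeff U).and ((eventually_analyticAt_rep_coeff H).and
    (eventually_eventually_nhds.2
      (eventually_funAct_eq_sum_range L (Nat.lt_succ_self L.natDegree))))))))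
  refine ⟨δ, hδ, fun k => rep (L.coeff k), U, ⟨fun k hk => ⟨fun t ht => ?_, ?_⟩, fun t ht => ?_⟩,
    fun t ht => (hball t ht).2.2.2.1, fun t₀ ht₀ hne u hu => ?_⟩
  · exact (hball t ht).2.2.1 k (Finset.mem_range.2 (by omega))
  · exact congrArg Subtype.val (mk_rep (L.coeff k))
  · exact (hball t ht).2.1
  · obtain ⟨h1, -, -, -, h5, h6⟩ := hball t₀ ht₀
    have hLu : funAct L u =ᶠ[𝓝 t₀] fun _ => 0 := by
      filter_upwards [h6, hu.2] with t h7 h8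
      rw [h7, h8]
    obtain ⟨hUu, hMu⟩ := h1 u hu.1 hLu
    obtain ⟨c, hc⟩ := exists_eq_sum_zpow Finset.univ hl hne (analyticAt_funAct h5 hu.1) hMu
    exact ⟨c, (funAct_congr U hc.symm).trans hUu.symm⟩

theorem FEquiv.onlyMeromorphicSolutions {L : HolOp} {n : ℕ} {l : Fin n → ℤ}
    (hl : Function.Injective l) (h : FEquiv L (ofEuler (∏ i, (X - C ((l i : ℤ) : ℂ))))) :
    OnlyMeromorphicSolutions L := by
  obtain ⟨δ, hδ, a, U, ha, hU, hsol⟩ := h.exists_solutions_eq hl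
  refine ⟨δ, hδ, a, ha, fun t₀ ht₀ hne u hu => ?_⟩
  obtain ⟨c, hc⟩ := hsol t₀ ht₀ hne u hu
  refine ⟨_, fun t ht => analyticAt_funAct (hU t ht.1) ?_, ?_, hc⟩
  · exact Finset.analyticAt_fun_sum _ fun i _ => analyticAt_const.mul (analyticAt_id.zpow ht.2)
  · have hφ : MeromorphicAt (fun t : ℂ => ∑ i, c i * t ^ l i) 0 :=
      MeromorphicAt.fun_sum fun i _ =>
        (MeromorphicAt.const (c i) 0).mul ((MeromorphicAt.id (𝕜 := ℂ) 0).zpow (l i))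
    have hφk (k : ℕ) : MeromorphicAt (eulerFun^[k] fun t : ℂ => ∑ i, c i * t ^ l i) 0 := by
      induction k with
      | zero => exact hφ
      | succ k ih =>
        rw [Function.iterate_succ_apply']
        exact (MeromorphicAt.id _).mul ih.deriv
    exact MeromorphicAt.fun_sum fun k _ => ((analyticAt_rep _).meromorphicAt).mul (hφk k)

/-- For nonnegative exponents the powers are analytic at `0` as well, and so are the coefficients of
`U`, so the formula for the solution holds across the origin. -/
theorem FEquiv.onlyHolomorphicSolutions {L : HolOp} {n : ℕ} {l : Fin n → ℤ}
    (hl : Function.Injective l) (hl0 : ∀ i, 0 ≤ l i)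
    (h : FEquiv L (ofEuler (∏ i, (X - C ((l i : ℤ) : ℂ))))) : OnlyHolomorphicSolutions L := by
  obtain ⟨δ, hδ, a, U, ha, hU, hsol⟩ := h.exists_solutions_eq hl
  refine ⟨δ, hδ, a, ha, fun t₀ ht₀ hne u hu => ?_⟩
  obtain ⟨c, hc⟩ := hsol t₀ ht₀ hne u hu
  refine ⟨_, fun t ht => analyticAt_funAct (hU t ht) ?_, hc⟩
  exact Finset.analyticAt_fun_sum _ fun i _ =>
    analyticAt_const.mul (analyticAt_id.zpow_nonneg (hl0 i))

end HolOp

end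

theorem proposition2 (L : HolOp) (hL : HolOp.IsFuchsian L) :
    (HolOp.OnlyMeromorphicSolutions L ↔
      ∃ l : Fin L.natDegree → ℤ, Function.Injective l ∧
        HolOp.FEquiv L (HolOp.ofEuler (∏ i, (Polynomial.X - Polynomial.C ((l i : ℤ) : ℂ))))) ∧
    (HolOp.OnlyHolomorphicSolutions L ↔
      ∃ l : Fin L.natDegree → ℤ, Function.Injective l ∧ (∀ i, 0 ≤ l i) ∧
        HolOp.FEquiv L (HolOp.ofEuler (∏ i, (Polynomial.X - Polynomial.C ((l i : ℤ) : ℂ))))) := by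
  refine ⟨⟨fun h => h.exists_fEquiv hL, ?_⟩, ⟨fun h => h.exists_fEquiv hL, ?_⟩⟩
  · rintro ⟨l, hl, h⟩
    exact h.onlyMeromorphicSolutions hl
  · rintro ⟨l, hl, hl0, h⟩
    exact h.onlyHolomorphicSolutions hl hl0
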